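/- Let $a \ge 2$ be a real number that is right-computably enumerable in $0'$, i.e. the set of rationals greater than $a$ is computably enumerable relative to the halting problem. Recall that the irrationality exponent of a real number $x$ is the supremum of the real numbers $z$ for which $0 < |x - p/q| < q^{-z}$ holds for infinitely many integer pairs $(p,q)$ with $q > 0$. Then there are computable sequences $(m_k)_{k\ge1}$, $(M_k)_{k \ge 1}$ of positive integers and $(b_k)_{k\ge 1}$ of rationals, with $m_k \ge 2$, $(M_k)$ strictly increasing and $b_k > 2$, and a computable Cantor-like construction in the manner of Jarník, as follows. Level $0$ consists of the interval $[0,1]$; for $k \ge 1$, level $k$ consists of $m_1 \cdots m_k$ intervals of the form $[p/q - q^{-b_k},\, p/q + q^{-b_k}]$ with $q$ prime and $M_k < q < 2M_k$, with exactly $m_k$ of them in each interval of level $k-1$ and inside its interior, and any two of them separated by a gap of length at least $1/(8M_k^2)$; the pairs $(p,q)$ of all the intervals, listed from left to right, are computable from the level and the position in the list; and there is $c > 0$ with $m_{k+1} \ge c\, M_{k+1}^2 / (M_k^{b_k} \log M_{k+1})$ for all $k \ge 1$. Let $K$ be the limit set, i.e. the intersection over all $k$ of the union of the intervals of level $k$.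 Then: 1. $K$ contains uncountably many real numbers with irrationality exponent equal to $a$; 2. the set of those numbers in $K$ with irrationality exponent equal to $a$ that are computable is countably infinite; 3. there is a natural (uniform) measure $\nu$ on $K$, i.e. a probability measure on $K$ that gives mass $1/(m_1\cdots m_k)$ to each interval of level $k$, and $\nu$ concentrates on the numbers with irrationality exponent $a$: $\nu$-almost every $x$ has irrationality exponent equal to $a$. -/

import Mathlib

open MeasureTheory

/-- The halting problem `0'`, as a (total, `0`-`1` valued) oracle: `n` is mapped to `1` if the
`n`-th program halts on input `n`, and to `0` otherwise. -/
noncomputable def zeroJump : ℕ →. ℕ := fun n =>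
  open Classical in
  Part.some (if ((Denumerable.ofNat Nat.Partrec.Code n).eval n).Dom then 1 else 0)

/-- `x` is right-computably enumerable in `0'`: the set of rational numbers `p / (n + 1)` greater
than `x` is computably enumerable in `0'`, that is, it is the domain of a partial function which is
recursive in `0'`. -/
def IsRightCEInZeroJump (x : ℝ) : Prop :=
  ∃ f : ℤ × ℕ →. ℕ, RecursiveIn {zeroJump} f ∧
    ∀ (p : ℤ) (n : ℕ), (f (p, n)).Dom ↔ x < (p : ℝ) / ((n : ℝ) + 1)

/-- A computable sequence of rational numbers. -/
def IsComputableRatSeq (r : ℕ → ℚ) : Prop :=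
  ∃ f : ℕ → ℤ × ℕ, Computable f ∧ ∀ j, r j = ((f j).1 : ℚ) / (((f j).2 : ℚ) + 1)

/-- `x` is a computable real number. -/
def IsComputableReal (x : ℝ) : Prop :=
  ∃ r : ℕ → ℚ, IsComputableRatSeq r ∧ ∀ j : ℕ, |x - (r j : ℝ)| < 1 / (2 : ℝ) ^ j

/-- The irrationality exponent of `x` is (finite and) equal to `a`. -/
def HasIrrationalityExponent (x a : ℝ) : Prop :=
  IsLUB {z : ℝ | {pq : ℤ × ℤ | 0 < pq.2 ∧ 0 < |x - (pq.1 : ℝ) / (pq.2 : ℝ)| ∧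
    |x - (pq.1 : ℝ) / (pq.2 : ℝ)| < 1 / (pq.2 : ℝ) ^ z}.Infinite} a

/-- The discrete data of a Cantor-like construction in the manner of Jarník. For `k ≥ 1`,
each interval of level `k - 1` is split into `m k` intervals of level `k`; the intervals of level
`k` are numbered from left to right, starting from `0`, and the `i`-th one is centred at
`p k i / q k i` with radius `(q k i) ^ (-b k)`, where `M k < q k i < 2 * M k`.
The only interval of level `0` is `[0, 1]`. -/
structure JarnikData where
  /-- the branching numbers -/
  m : ℕ → ℕ
  /-- the sizes of the denominators -/
  M : ℕ → ℕ
  /-- the exponents -/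
  b : ℕ → ℚ
  /-- the numerators of the centres -/
  p : ℕ → ℕ → ℕ
  /-- the denominators of the centres -/
  q : ℕ → ℕ → ℕ

namespace JarnikData

variable (D : JarnikData)

/-- The number `m 1 * ⋯ * m k` of intervals of level `k`. -/
def count (k : ℕ) : ℕ := ∏ j ∈ Finset.range k, D.m (j + 1)

/-- The left endpoint of the `i`-th interval of level `k`. -/
noncomputable def left : ℕ → ℕ → ℝ
  | 0, _ => 0
  | k + 1, i => (D.p (k + 1) i : ℝ) / (D.q (k + 1) i : ℝ)
      - (D.q (k + 1) i : ℝ) ^ (-(D.b (k + 1) : ℝ))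

/-- The right endpoint of the `i`-th interval of level `k`. -/
noncomputable def right : ℕ → ℕ → ℝ
  | 0, _ => 1
  | k + 1, i => (D.p (k + 1) i : ℝ) / (D.q (k + 1) i : ℝ)
      + (D.q (k + 1) i : ℝ) ^ (-(D.b (k + 1) : ℝ))

/-- The `i`-th interval of level `k`. -/
def interval (k i : ℕ) : Set ℝ := Set.Icc (D.left k i) (D.right k i)

/-- The data describe a Cantor-like construction in the manner of Jarník. -/
structure IsCantorLike : Prop where
  /-- every interval is split into at least two intervals -/
  two_le_m : ∀ k, 1 ≤ k → 2 ≤ D.m k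
  M_lt : ∀ k, 1 ≤ k → D.M k < D.M (k + 1)
  two_lt_b : ∀ k, 1 ≤ k → 2 < D.b k
  prime_q : ∀ k, 1 ≤ k → ∀ i < D.count k, (D.q k i).Prime
  lt_q : ∀ k, 1 ≤ k → ∀ i < D.count k, D.M k < D.q k i
  q_lt : ∀ k, 1 ≤ k → ∀ i < D.count k, D.q k i < 2 * D.M k
  /-- the intervals numbered `i * m (k + 1) + c` with `c < m (k + 1)` of level `k + 1` lie inside
  the `i`-th interval of level `k` (in its interior, so that it does not matter for the limit set
  whether the intervals are taken open or closed) -/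
  nested : ∀ k, ∀ i < D.count k, ∀ c < D.m (k + 1),
    D.interval (k + 1) (i * D.m (k + 1) + c) ⊆ Set.Ioo (D.left k i) (D.right k i)
  /-- distinct intervals of level `k` are separated by gaps of length at least `1 / (8 M_k ^ 2)` -/
  gap : ∀ k, 1 ≤ k → ∀ i, i + 1 < D.count k →
    D.right k i + 1 / (8 * (D.M k : ℝ) ^ 2) ≤ D.left k (i + 1)
  /-- up to a constant factor, the branching numbers are at least the number
  `M_{k+1} ^ 2 / (M_k ^ {b_k} * log M_{k+1})` that the density of the primes provides -/
  branching : ∃ c : ℝ, 0 < c ∧ ∀ k, 1 ≤ k →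
    c * (D.M (k + 1) : ℝ) ^ 2 / ((D.M k : ℝ) ^ (D.b k : ℝ) * Real.log (D.M (k + 1))) ≤ D.m (k + 1)

/-- The construction is computable. -/
structure IsComputable : Prop where
  m : Computable D.m
  M : Computable D.M
  b : IsComputableRatSeq D.b
  p : Computable₂ D.p
  q : Computable₂ D.q

/-- The limit set: the intersection over all `k` of the union of the intervals of level `k`. -/
def limitSet : Set ℝ := ⋂ k, ⋃ i < D.count k, D.interval k i

/-- `ν` is the natural (uniform) measure on the limit set: a probability measure on the limit set
that gives the same mass to all the intervals of the same level. -/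
structure IsNaturalMeasure (ν : Measure ℝ) : Prop where
  isProbabilityMeasure : IsProbabilityMeasure ν
  compl_limitSet : ν D.limitSetᶜ = 0
  interval : ∀ k, ∀ i < D.count k, ν (D.interval k i) = (D.count k : ENNReal)⁻¹

end JarnikData

/-! The construction is arranged so that every point of `K` has irrationality exponent `a`. The
three claims then become claims about `K` itself.

Exponents. The graph of a function recursive in `0'` is `Σ₂` (`isSigmaTwo_graph`), so `a < r` can be
written `∃ s, ∀ t, R (r, s, t)` with `R` primitive recursive. Call a pair `(r, s)` a clause; it is
refuted at the first `t` where `R` fails. Up to rounding, a lower limit `2 k + 1` and an upper limit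
`B k`, `u k` is `k` times the least `r` over the clauses numbered below `k` that are not refuted by
stage `k` and have no smaller clause being refuted exactly at stage `k`. A true clause is eventually
always counted, so `limsup u k / k ≤ a`. At infinitely many "true stages" only true clauses are
counted (`exists_true_stage`), so `u k ≥ a k` there. Put `b k = u k / k`.

Intervals. The centres of level `k + 1` are fractions with prime denominator between `M` and `2 M`,
placed in a short window to the right of the parent's centre and away from all fractions whose
denominators lie in a certain range. A Chebyshev bound for primes supplies the candidates, and a
count over dyadic ranges of denominators shows that at most about half of them are spoiled
(`le_card_candidates_avoiding`). The remaining half is enough for the required branching numbers.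

Exponent of the points. A point of `K` is within `q ^ (-b k)` of a centre at every level, which
gives exponent at least `limsup b k = a`. Conversely, a fraction `p / t` other than the relevant
centre is kept off either by the avoidance condition or because distinct fractions with denominators
`q` and `t` differ by at least `1 / (q t)`. Both give a distance of at least `t ^ (-2)` up to a
factor `t ^ o(1)`. A fraction equal to the centre is not approached too closely either, since the
children lie to one side of the centre (`abs_sub_div_ge`).

Measure and computable points. A number `t ∈ [0, 1)` serves as an address: at level `k` it selects
interval number `⌊t * count k⌋`. This is an injection into `K`, it carries Lebesgue measure to the
natural measure, and the addresses `1 / count (n + 1)` give infinitely many computable points. -/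

/-! ### Primes between consecutive powers of two. -/

/-- Erdős's factorisation from the proof of Bertrand's postulate, keeping the primes in `(n, 2n]`.
Each prime power in the central binomial coefficient is at most `2n`. Primes above `√(2n)` occur at
most once, and those in `(2n/3, n]` not at all, so the middle range is bounded by a primorial. -/
theorem centralBinom_le_pow_card_primes (n : ℕ) (n_large : 2 < n) :
    n.centralBinom ≤ (2 * n) ^ Nat.sqrt (2 * n) * 4 ^ (2 * n / 3) *
      (2 * n) ^ ((Finset.Ioc n (2 * n)).filter Nat.Prime).card := by
  have n_pos : 0 < n := by omega
  have n2_pos : 1 ≤ 2 * n := by omega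
  let S := {p ∈ Finset.range (2 * n + 1) | Nat.Prime p}
  let f x := x ^ n.centralBinom.factorization x
  have hS : n.centralBinom = ∏ x ∈ S, f x := by
    rw [← n.prod_pow_factorization_centralBinom]
    refine (Finset.prod_filter_of_ne fun p _ h => ?_).symm
    contrapose h
    rw [Nat.factorization_eq_zero_of_not_prime _ h, pow_zero]
  rw [hS, ← Finset.prod_filter_mul_prod_filter_not S (· ≤ n)]
  apply mul_le_mul'
  · rw [← Finset.prod_filter_mul_prod_filter_not _ (· ≤ Nat.sqrt (2 * n))]
    apply mul_le_mul'
    · refine (Finset.prod_le_prod' fun p _ => (?_ : f p ≤ 2 * n)).trans ?_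
      · exact Nat.pow_factorization_choose_le (mul_pos two_pos n_pos)
      have : (Finset.Icc 1 (Nat.sqrt (2 * n))).card = Nat.sqrt (2 * n) := by
        rw [Nat.card_Icc, Nat.add_sub_cancel]
      rw [Finset.prod_const]
      refine pow_right_mono₀ n2_pos ((Finset.card_le_card fun x hx => ?_).trans this.le)
      simp only [S, Finset.mem_filter] at hx
      exact Finset.mem_Icc.mpr ⟨hx.1.1.2.one_lt.le, hx.2⟩
    · refine le_trans ?_ (primorial_le_four_pow (2 * n / 3))
      let R := {p ∈ Finset.range (2 * n / 3 + 1) | Nat.Prime p}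
      refine (Finset.prod_le_prod' (g := fun p => if p ∈ R then p else 1) fun p hp => ?_).trans ?_
      · simp only [S, Finset.mem_filter, Finset.mem_range] at hp
        obtain ⟨⟨⟨-, hpp⟩, hpn⟩, hps⟩ := hp
        split_ifs with hR
        · refine (pow_right_mono₀ hpp.one_lt.le ?_).trans (pow_one p).le
          exact Nat.factorization_choose_le_one (Nat.sqrt_lt'.mp <| not_le.1 hps)
        · simp only [R, Finset.mem_filter, Finset.mem_range, hpp, and_true] at hR
          simp only [f]
          rw [Nat.factorization_centralBinom_of_two_mul_self_lt_three_mul n_large hpn (by omega),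
            pow_zero]
      · rw [Finset.prod_ite_mem, primorial]
        refine Finset.prod_le_prod_of_subset_of_one_le' Finset.inter_subset_right ?_
        exact fun p hp _ => (Finset.mem_filter.1 hp).2.one_lt.le
  · refine (Finset.prod_le_prod' fun p _ => (?_ : f p ≤ 2 * n)).trans ?_
    · exact Nat.pow_factorization_choose_le (mul_pos two_pos n_pos)
    rw [Finset.prod_const]
    refine pow_right_mono₀ n2_pos (Finset.card_le_card fun x hx => ?_)
    simp only [S, Finset.mem_filter, Finset.mem_range, Finset.mem_Ioc] at hx ⊢
    exact ⟨⟨by omega, by omega⟩, hx.1.2⟩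

/-- A lower bound of Chebyshev type for the number of primes between consecutive powers of two. -/
theorem two_pow_le_mul_card_primes {N : ℕ} (hN : 16 ≤ N) :
    2 ^ N ≤ 8 * N * ((Finset.Ioo (2 ^ N) (2 * 2 ^ N)).filter Nat.Prime).card := by
  have h16 : 2 ^ 16 ≤ 2 ^ N := Nat.pow_le_pow_right (by norm_num) hN
  have hcard : ((Finset.Ioc (2 ^ N) (2 * 2 ^ N)).filter Nat.Prime).card
      ≤ ((Finset.Ioo (2 ^ N) (2 * 2 ^ N)).filter Nat.Prime).card := by
    refine Finset.card_le_card fun p hp => ?_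
    simp only [Finset.mem_filter, Finset.mem_Ioc, Finset.mem_Ioo] at hp ⊢
    refine ⟨⟨hp.1.1, lt_of_le_of_ne hp.1.2 fun h => ?_⟩, hp.2⟩
    rw [h] at hp
    exact Nat.not_prime_mul (by norm_num) (by omega) hp.2
  set c := ((Finset.Ioo (2 ^ N) (2 * 2 ^ N)).filter Nat.Prime).card
  have h1 := Nat.four_pow_lt_mul_centralBinom (2 ^ N) (by omega)
  have h2 := centralBinom_le_pow_card_primes (2 ^ N) (by omega)
  set r := N / 2 with hr
  have hsqrt : Nat.sqrt (2 * 2 ^ N) ≤ 2 ^ (r + 1) := by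
    rw [← Nat.lt_succ_iff, Nat.sqrt_lt']
    calc 2 * 2 ^ N = 2 ^ (N + 1) := by ring
      _ ≤ 2 ^ ((r + 1) * 2) := Nat.pow_le_pow_right (by norm_num) (by omega)
      _ = (2 ^ (r + 1)) ^ 2 := by rw [pow_mul]
      _ < _ := Nat.pow_lt_pow_left (Nat.lt_succ_self _) (by norm_num)
  have hn2 : 1 ≤ 2 * 2 ^ N := by omega
  have h3 : 4 ^ (2 ^ N) < 2 ^ N * ((2 * 2 ^ N) ^ (2 ^ (r + 1)) * 4 ^ (2 * 2 ^ N / 3) *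
      (2 * 2 ^ N) ^ c) := by
    refine h1.trans_le (Nat.mul_le_mul_left _ (h2.trans ?_))
    refine Nat.mul_le_mul (Nat.mul_le_mul_right _ ?_) ?_
    · exact Nat.pow_le_pow_right hn2 hsqrt
    · exact Nat.pow_le_pow_right hn2 hcard
  have h4 : (2 : ℕ) ^ (2 * 2 ^ N) < 2 ^ (N + (N + 1) * 2 ^ (r + 1) + 2 * (2 * 2 ^ N / 3)
      + (N + 1) * c) := by
    calc (2 : ℕ) ^ (2 * 2 ^ N) = 4 ^ (2 ^ N) := by rw [pow_mul]; norm_num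
      _ < _ := h3
      _ = _ := by
        have e1 : 2 * 2 ^ N = 2 ^ (N + 1) := by ring
        have e2 : (4 : ℕ) ^ (2 * 2 ^ N / 3) = 2 ^ (2 * (2 * 2 ^ N / 3)) := by
          rw [pow_mul]; norm_num
        rw [e2, e1, ← pow_mul, ← pow_mul, ← pow_add, ← pow_add, ← pow_add]
        congr 1; ring
  have h5 := (Nat.pow_lt_pow_iff_right (by norm_num : 1 < 2)).1 h4
  -- This is where `16 ≤ N` is needed: the inequality holds at `r = 8` and fails at `r = 7`.
  have h6 : ∀ r, 8 ≤ r → 3 * (2 * (2 * r + 1) + 1) * 2 ≤ 2 ^ r := by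
    intro r hr
    induction r, hr using Nat.le_induction with
    | base => norm_num
    | succ r hr ih => rw [pow_succ]; omega
  have h7 : 3 * (N + (N + 1) * 2 ^ (r + 1)) ≤ 2 ^ N := by
    have h8 := h6 r (by omega)
    have h9 : 1 ≤ 2 ^ (r + 1) := Nat.one_le_two_pow
    calc 3 * (N + (N + 1) * 2 ^ (r + 1)) ≤ 3 * (N * 2 ^ (r + 1) + (N + 1) * 2 ^ (r + 1)) := by
          gcongr; exact Nat.le_mul_of_pos_right _ h9
      _ = 3 * (2 * N + 1) * 2 * 2 ^ r := by ring
      _ ≤ 3 * (2 * (2 * r + 1) + 1) * 2 * 2 ^ r := by gcongr; omega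
      _ ≤ 2 ^ r * 2 ^ r := by gcongr
      _ = 2 ^ (r + r) := by rw [pow_add]
      _ ≤ 2 ^ N := Nat.pow_le_pow_right (by norm_num) (by omega)
  -- In `h5` the primorial uses up at most two thirds of the exponent `2 * 2 ^ N`. The small primes
  -- take at most half of what is left, by `h7`.
  have h10 : 2 ^ N ≤ 3 * ((N + 1) * c) := by omega
  calc 2 ^ N ≤ 3 * ((N + 1) * c) := h10
    _ ≤ 3 * ((N + N) * c) := by gcongr; omega
    _ ≤ 8 * N * c := by nlinarith [Nat.zero_le (N * c)]

/-! ### Counting fractions with prime denominators that avoid other fractions. -/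

theorem one_div_mul_le_abs_div_sub_div {p p' : ℤ} {q q' : ℕ} (hq : 0 < q) (hq' : 0 < q')
    (h : (p : ℝ) / q ≠ (p' : ℝ) / q') : 1 / ((q : ℝ) * q') ≤ |(p : ℝ) / q - (p' : ℝ) / q'| := by
  have hqR : (0 : ℝ) < q := by exact_mod_cast hq
  have hqR' : (0 : ℝ) < q' := by exact_mod_cast hq'
  have hne : p * q' - q * p' ≠ 0 := by
    intro h0
    apply h
    rw [div_eq_div_iff hqR.ne' hqR'.ne']
    have : p * q' = p' * q := by linarith
    exact_mod_cast this
  have h1 : (1 : ℝ) ≤ |(p : ℝ) * q' - q * p'| := by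
    have := Int.one_le_abs hne
    exact_mod_cast this
  rw [div_sub_div _ _ hqR.ne' hqR'.ne', abs_div, abs_of_pos (mul_pos hqR hqR')]
  gcongr

/-- A set of reals with gaps at least `g` has at most `w / g + 1` elements in an interval of
length `w`. -/
theorem card_le_of_separated {ι : Type*} (T : Finset ι) (f : ι → ℝ) {l w g : ℝ} (hg : 0 < g)
    (hw : 0 ≤ w) (hsep : ∀ x ∈ T, ∀ y ∈ T, x ≠ y → g ≤ |f x - f y|)
    (hl : ∀ x ∈ T, l ≤ f x) (hr : ∀ x ∈ T, f x ≤ l + w) : (T.card : ℝ) ≤ w / g + 1 := by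
  have hcard : T.card ≤ (Finset.range (⌊w / g⌋₊ + 1)).card := by
    refine Finset.card_le_card_of_injOn (fun x => ⌊(f x - l) / g⌋₊) (fun x hx => ?_) ?_
    · simp only [Finset.coe_range, Set.mem_Iio, Nat.lt_succ_iff]
      refine Nat.floor_le_floor ?_
      have := hr x hx
      gcongr
      linarith
    · intro x hx y hy hxy
      by_contra hne
      have hxn : 0 ≤ (f x - l) / g := div_nonneg (by linarith [hl x hx]) hg.le
      have hyn : 0 ≤ (f y - l) / g := div_nonneg (by linarith [hl y hy]) hg.le
      have h1 := Nat.floor_le hxn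
      have h2 := Nat.lt_floor_add_one ((f x - l) / g)
      have h3 := Nat.floor_le hyn
      have h4 := Nat.lt_floor_add_one ((f y - l) / g)
      simp only at hxy
      rw [hxy] at h1 h2
      have h5 : |(f x - l) / g - (f y - l) / g| < 1 := by rw [abs_lt]; constructor <;> linarith
      rw [← sub_div, abs_div, abs_of_pos hg, div_lt_one hg] at h5
      have := hsep x hx y hy hne
      rw [show f x - l - (f y - l) = f x - f y by ring] at h5
      linarith
  rw [Finset.card_range] at hcard
  calc (T.card : ℝ) ≤ ((⌊w / g⌋₊ + 1 : ℕ) : ℝ) := by exact_mod_cast hcard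
    _ = (⌊w / g⌋₊ : ℝ) + 1 := by push_cast; ring
    _ ≤ w / g + 1 := by gcongr; exact Nat.floor_le (by positivity)

/-- The denominator of `n / D` in lowest terms. -/
def reducedDen (D n : ℕ) : ℕ := D / n.gcd D

/-- The numerator of `n / D` in lowest terms. -/
def reducedNum (D n : ℕ) : ℕ := n / n.gcd D

theorem reducedDen_pos {D : ℕ} (hD : 0 < D) (n : ℕ) : 0 < reducedDen D n :=
  Nat.div_pos (Nat.le_of_dvd hD (Nat.gcd_dvd_right n D)) (Nat.gcd_pos_of_pos_right n hD)

theorem reducedDen_dvd {D : ℕ} (n : ℕ) : reducedDen D n ∣ D :=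
  Nat.div_dvd_of_dvd (Nat.gcd_dvd_right n D)

theorem reducedNum_div_reducedDen {D : ℕ} (hD : 0 < D) (n : ℕ) :
    (reducedNum D n : ℝ) / reducedDen D n = (n : ℝ) / D := by
  have hg : 0 < n.gcd D := Nat.gcd_pos_of_pos_right n hD
  have hd : (0 : ℝ) < reducedDen D n := by exact_mod_cast reducedDen_pos hD n
  have hDR : (0 : ℝ) < D := by exact_mod_cast hD
  rw [div_eq_div_iff hd.ne' hDR.ne']
  have h1 : reducedNum D n * n.gcd D = n := Nat.div_mul_cancel (Nat.gcd_dvd_left n D)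
  have h2 : reducedDen D n * n.gcd D = D := Nat.div_mul_cancel (Nat.gcd_dvd_right n D)
  have : reducedNum D n * D = n * reducedDen D n := by
    calc reducedNum D n * D = reducedNum D n * (reducedDen D n * n.gcd D) := by rw [h2]
      _ = (reducedNum D n * n.gcd D) * reducedDen D n := by ring
      _ = n * reducedDen D n := by rw [h1]
  exact_mod_cast this

theorem reducedDen_mul_div {D p q : ℕ} (hD : 0 < D) (hqD : q ∣ D) (hpq : p.Coprime q) :
    reducedDen D (p * (D / q)) = q := by
  obtain ⟨e, rfl⟩ := hqD
  have hq : 0 < q := Nat.pos_of_mul_pos_right hD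
  have he : 0 < e := Nat.pos_of_mul_pos_left hD
  rw [reducedDen, Nat.mul_div_cancel_left _ hq, Nat.gcd_mul_right, hpq.gcd_eq_one, one_mul,
    Nat.mul_div_cancel _ he]

/-- Fractions `n / D` in `(s, s + W]` whose reduced denominators are primes greater than `M`. -/
noncomputable def candidates (D M : ℕ) (s W : ℝ) : Finset ℕ := by
  classical exact
    {n ∈ Finset.range D | (reducedDen D n).Prime ∧ M < reducedDen D n ∧
      s < (n : ℝ) / D ∧ (n : ℝ) / D ≤ s + W}

theorem mem_candidates {D M n : ℕ} {s W : ℝ} : n ∈ candidates D M s W ↔ n < D ∧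
    (reducedDen D n).Prime ∧ M < reducedDen D n ∧ s < (n : ℝ) / D ∧ (n : ℝ) / D ≤ s + W := by
  simp [candidates]

/-- Each prime `q` in `(M, 2M)` has at least `q W - 1 ≥ M W / 2` multiples of `1 / q` in the window.
Since the window lies in `[0, 1)`, these fractions are in lowest terms, so the reduced denominator
recovers `q` and no fraction is counted twice. -/
theorem card_primes_mul_le_card_candidates {D M : ℕ} {s W : ℝ} (hM : 0 < M) (hD : 0 < D)
    (hdvd : ∀ q, q.Prime → q < 2 * M → q ∣ D) (hs : 0 ≤ s) (hsW : s + W < 1)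
    (hMW : 2 ≤ M * W) :
    (((Finset.Ioo M (2 * M)).filter Nat.Prime).card : ℝ) * (M * W / 2)
      ≤ (candidates D M s W).card := by
  classical
  have hMR : (0 : ℝ) < M := by exact_mod_cast hM
  have hW : 0 < W := by by_contra h; push Not at h; nlinarith
  have hDR : (0 : ℝ) < D := by exact_mod_cast hD
  let P := (Finset.Ioo M (2 * M)).filter Nat.Prime
  let I : ℕ → Finset ℕ := fun q => Finset.Ioc ⌊(q : ℝ) * s⌋₊ ⌊(q : ℝ) * (s + W)⌋₊
  have hI : ∀ q ∈ P, (M : ℝ) * W / 2 ≤ (I q).card := by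
    intro q hq
    simp only [P, Finset.mem_filter, Finset.mem_Ioo] at hq
    have hqM : (M : ℝ) ≤ q := by exact_mod_cast hq.1.1.le
    have hq0 : (0 : ℝ) < q := by linarith
    have h1 := Nat.floor_le (a := (q : ℝ) * s) (by positivity)
    have h2 := Nat.lt_floor_add_one ((q : ℝ) * (s + W))
    have hle : ⌊(q : ℝ) * s⌋₊ ≤ ⌊(q : ℝ) * (s + W)⌋₊ := Nat.floor_le_floor (by gcongr; linarith)
    simp only [I, Nat.card_Ioc]
    rw [Nat.cast_sub hle]
    have h3 : (M : ℝ) * W ≤ q * W := by gcongr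
    nlinarith
  have hinj : (P.sigma I).card ≤ (candidates D M s W).card := by
    have hmem : ∀ x ∈ P.sigma I, x.1.Prime ∧ M < x.1 ∧ x.1 ∣ D ∧ s < (x.2 : ℝ) / x.1 ∧
        (x.2 : ℝ) / x.1 ≤ s + W ∧ x.2.Coprime x.1 := by
      rintro ⟨q, p⟩ hx
      simp only [P, I, Finset.mem_sigma, Finset.mem_filter, Finset.mem_Ioo, Finset.mem_Ioc] at hx
      obtain ⟨⟨⟨hq1, hq2⟩, hqp⟩, hp1, hp2⟩ := hx
      have hq0 : (0 : ℝ) < q := by exact_mod_cast hqp.pos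
      rw [Nat.floor_lt (by positivity)] at hp1
      rw [Nat.le_floor_iff (by positivity)] at hp2
      have hlt : (p : ℝ) < q := by nlinarith
      have hp0 : 0 < p := by
        have : (0 : ℝ) < p := lt_of_le_of_lt (by positivity) hp1
        exact_mod_cast this
      refine ⟨hqp, hq1, hdvd q hqp hq2, ?_, ?_, ?_⟩
      · rw [lt_div_iff₀ hq0]; linarith
      · rw [div_le_iff₀ hq0]; linarith
      · exact Nat.Coprime.symm ((Nat.Prime.coprime_iff_not_dvd hqp).2 fun h =>
          absurd (Nat.le_of_dvd hp0 h) (not_le.2 (by exact_mod_cast hlt)))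
    have hval : ∀ x ∈ P.sigma I, ((x.2 * (D / x.1) : ℕ) : ℝ) / D = (x.2 : ℝ) / x.1 := by
      intro x hx
      obtain ⟨h1, -, h3, -⟩ := hmem x hx
      have hq0 : (0 : ℝ) < x.1 := by exact_mod_cast h1.pos
      rw [Nat.cast_mul, Nat.cast_div h3 hq0.ne']
      field_simp
    refine Finset.card_le_card_of_injOn (fun x => x.2 * (D / x.1)) (fun x hx => ?_) ?_
    · rw [Finset.mem_coe] at hx ⊢
      obtain ⟨h1, h2, h3, h4, h5, h6⟩ := hmem x hx
      rw [mem_candidates, hval x hx, reducedDen_mul_div hD h3 h6]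
      refine ⟨?_, h1, h2, h4, h5⟩
      have : ((x.2 * (D / x.1) : ℕ) : ℝ) / D < 1 := by rw [hval x hx]; linarith
      rw [div_lt_one hDR] at this
      exact_mod_cast this
    · intro x hx y hy hxy
      rw [Finset.mem_coe] at hx hy
      obtain ⟨h1, h2, h3, h4, h5, h6⟩ := hmem x hx
      obtain ⟨g1, g2, g3, g4, g5, g6⟩ := hmem y hy
      simp only at hxy
      have hq : x.1 = y.1 := by
        rw [← reducedDen_mul_div hD h3 h6, ← reducedDen_mul_div hD g3 g6, hxy]
      obtain ⟨q, p⟩ := x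
      obtain ⟨q', p'⟩ := y
      simp only at hq
      subst hq
      simp only at hxy
      rw [Nat.eq_of_mul_eq_mul_right (Nat.div_pos (Nat.le_of_dvd hD h3) h1.pos) hxy]
  calc ((P.card : ℕ) : ℝ) * (M * W / 2) = ∑ q ∈ P, (M : ℝ) * W / 2 := by simp
    _ ≤ ∑ q ∈ P, ((I q).card : ℝ) := Finset.sum_le_sum hI
    _ = ((P.sigma I).card : ℝ) := by rw [Finset.card_sigma]; push_cast; rfl
    _ ≤ _ := by exact_mod_cast hinj

theorem candidates_separated {D M n n' : ℕ} (hD : 0 < D)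
    (hn2 : reducedDen D n < 2 * M) (hn2' : reducedDen D n' < 2 * M) (hne : n ≠ n') :
    1 / (4 * (M : ℝ) ^ 2) ≤ |(n : ℝ) / D - (n' : ℝ) / D| := by
  have hDR : (0 : ℝ) < D := by exact_mod_cast hD
  have hd := reducedDen_pos hD n
  have hd' := reducedDen_pos hD n'
  have hdR : (0 : ℝ) < reducedDen D n := by exact_mod_cast hd
  have hdR' : (0 : ℝ) < reducedDen D n' := by exact_mod_cast hd'
  have hlt : (reducedDen D n : ℝ) ≤ 2 * M := by exact_mod_cast hn2.le
  have hlt' : (reducedDen D n' : ℝ) ≤ 2 * M := by exact_mod_cast hn2'.le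
  have key := one_div_mul_le_abs_div_sub_div (p := reducedNum D n) (p' := reducedNum D n') hd hd'
  simp only [Int.cast_natCast, reducedNum_div_reducedDen hD] at key
  refine le_trans ?_ (key ?_)
  · apply one_div_le_one_div_of_le (by positivity)
    nlinarith
  · intro h
    rw [div_left_inj' hDR.ne'] at h
    exact hne (by exact_mod_cast h)

/-- `y` is not too close to any fraction with a denominator between `2 ^ j₀` and `2 ^ j₁`. -/
def AvoidsFractions (A : ℝ) (j₀ j₁ : ℕ) (y : ℝ) : Prop :=
  ∀ t : ℕ, 2 ^ j₀ ≤ t → t < 2 ^ j₁ → ∀ p : ℤ, 2 / (A * (t : ℝ) ^ 2) ≤ |y - (p : ℝ) / t|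

/-- The number of candidates close to a fraction whose denominator lies in a given dyadic range. -/
theorem card_candidates_near_le {D M j : ℕ} {s W A : ℝ} (hM : 0 < M) (hD : 0 < D)
    (hdvd : ∀ n, (reducedDen D n).Prime → reducedDen D n < 2 * M) (hW : 0 < W) (hA : 16 ≤ A)
    (T : Finset ℕ) (hT : T ⊆ candidates D M s W)
    (hnear : ∀ n ∈ T, ∃ t : ℕ, 2 ^ j ≤ t ∧ t < 2 ^ (j + 1) ∧ ∃ p : ℤ,
      |(n : ℝ) / D - (p : ℝ) / t| < 2 / (A * (t : ℝ) ^ 2)) :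
    (T.card : ℝ) ≤ (4 * W * 4 ^ j + 2) * (16 * M ^ 2 / (A * 4 ^ j) + 1) := by
  classical
  have hMR : (0 : ℝ) < M := by exact_mod_cast hM
  set δ : ℝ := 2 / (A * 4 ^ j) with hδ
  have hδ0 : 0 < δ := by positivity
  -- One nearby fraction `ρ n` is fixed for each `n`. The count is then the number of values of `ρ`
  -- times the largest fibre, and both are bounded by separation. Outside `T` the value is
  -- irrelevant.
  have hnear' : ∀ n : ℕ, ∃ ρ : ℝ, n ∈ T → ∃ t : ℕ, 2 ^ j ≤ t ∧ t < 2 ^ (j + 1) ∧ ∃ p : ℤ,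
      ρ = (p : ℝ) / t ∧ |(n : ℝ) / D - ρ| ≤ δ := by
    intro n
    by_cases hn : n ∈ T
    · obtain ⟨t, ht, ht', p, hp⟩ := hnear n hn
      refine ⟨(p : ℝ) / t, fun _ => ⟨t, ht, ht', p, rfl, hp.le.trans ?_⟩⟩
      have htR : (2 : ℝ) ^ j ≤ t := by exact_mod_cast ht
      have : (4 : ℝ) ^ j ≤ (t : ℝ) ^ 2 := by
        calc (4 : ℝ) ^ j = ((2 : ℝ) ^ j) ^ 2 := by rw [← pow_mul, mul_comm, pow_mul]; norm_num
          _ ≤ _ := by gcongr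
      rw [hδ]
      gcongr
    · exact ⟨0, fun h => absurd h hn⟩
  choose ρ hρ using hnear'
  have hfib : ∀ r ∈ T.image ρ, ((T.filter (fun n => ρ n = r)).card : ℝ)
      ≤ 16 * M ^ 2 / (A * 4 ^ j) + 1 := by
    intro r _
    refine (card_le_of_separated _ (fun n : ℕ => (n : ℝ) / D) (l := r - δ) (w := 2 * δ)
      (g := 1 / (4 * (M : ℝ) ^ 2)) (by positivity) (by positivity) ?_ ?_ ?_).trans ?_
    · intro n hn n' hn' hne
      simp only [Finset.mem_filter] at hn hn'
      exact candidates_separated hD (hdvd _ (mem_candidates.1 (hT hn.1)).2.1)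
        (hdvd _ (mem_candidates.1 (hT hn'.1)).2.1) hne
    · intro n hn
      simp only [Finset.mem_filter] at hn
      obtain ⟨t, -, -, p, -, h⟩ := hρ n hn.1
      rw [hn.2, abs_le] at h
      linarith
    · intro n hn
      simp only [Finset.mem_filter] at hn
      obtain ⟨t, -, -, p, -, h⟩ := hρ n hn.1
      rw [hn.2, abs_le] at h
      linarith
    · rw [hδ]
      apply le_of_eq
      field_simp
      ring
  have himg : ((T.image ρ).card : ℝ) ≤ 4 * W * 4 ^ j + 2 := by
    refine (card_le_of_separated _ (fun r : ℝ => r) (l := s - δ) (w := W + 2 * δ)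
      (g := 1 / (4 * 4 ^ j)) (by positivity) (by positivity) ?_ ?_ ?_).trans ?_
    · intro r hr r' hr' hne
      rw [Finset.mem_image] at hr hr'
      obtain ⟨n, hn, rfl⟩ := hr
      obtain ⟨n', hn', rfl⟩ := hr'
      obtain ⟨t, ht, ht', p, hp, -⟩ := hρ n hn
      obtain ⟨u, hu, hu', p', hp', -⟩ := hρ n' hn'
      rw [hp, hp'] at hne ⊢
      have ht0 : 0 < t := lt_of_lt_of_le (by positivity) ht
      have hu0 : 0 < u := lt_of_lt_of_le (by positivity) hu
      have ht0R : (0 : ℝ) < t := by exact_mod_cast ht0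
      have hu0R : (0 : ℝ) < u := by exact_mod_cast hu0
      refine le_trans ?_ (one_div_mul_le_abs_div_sub_div ht0 hu0 hne)
      apply one_div_le_one_div_of_le (by positivity)
      have h1 : (t : ℝ) ≤ 2 ^ (j + 1) := by exact_mod_cast ht'.le
      have h2 : (u : ℝ) ≤ 2 ^ (j + 1) := by exact_mod_cast hu'.le
      calc (t : ℝ) * u ≤ 2 ^ (j + 1) * 2 ^ (j + 1) := by gcongr
        _ = 4 * (2 ^ j * 2 ^ j) := by ring
        _ = 4 * 4 ^ j := by rw [← mul_pow]; norm_num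
    · intro r hr
      rw [Finset.mem_image] at hr
      obtain ⟨n, hn, rfl⟩ := hr
      obtain ⟨t, -, -, p, -, h⟩ := hρ n hn
      have := mem_candidates.1 (hT hn)
      rw [abs_le] at h
      linarith [this.2.2.2.1]
    · intro r hr
      rw [Finset.mem_image] at hr
      obtain ⟨n, hn, rfl⟩ := hr
      obtain ⟨t, -, -, p, -, h⟩ := hρ n hn
      have := mem_candidates.1 (hT hn)
      rw [abs_le] at h
      linarith [this.2.2.2.2]
    · have e : (W + 2 * δ) / (1 / (4 * 4 ^ j)) = 4 * W * 4 ^ j + 16 / A := by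
        rw [hδ]; field_simp; ring
      rw [e]
      have : 16 / A ≤ 1 := by rw [div_le_one (by linarith)]; exact hA
      linarith
  have hsum : (T.card : ℝ) = ∑ r ∈ T.image ρ, ((T.filter (fun n => ρ n = r)).card : ℝ) := by
    rw [Finset.card_eq_sum_card_image ρ T]; push_cast; rfl
  rw [hsum]
  refine (Finset.sum_le_card_nsmul _ _ _ hfib).trans ?_
  rw [nsmul_eq_mul]
  gcongr

/-- A positive proportion of the candidates avoids fractions with smaller denominators. -/
theorem le_card_candidates_avoiding {D N j₀ j₁ : ℕ} {s W A : ℝ} (hD : 0 < D) (hN : 16 ≤ N)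
    (hdvd : ∀ q, q.Prime → (q ∣ D ↔ q < 2 * 2 ^ N)) (hs : 0 ≤ s) (hsW : s + W < 1)
    (hMW : 2 ≤ 2 ^ N * W) (hj : j₁ ≤ N) (hA : 2 ^ 13 * (N : ℝ) ^ 2 ≤ A)
    (hj₁ : 2 ^ j₁ * A ≤ 2 ^ N) (hj₀ : 2 ^ 12 * (N : ℝ) ^ 2 ≤ A * 4 ^ j₀ * W)
    (hWN : 256 * (N : ℝ) ^ 2 ≤ W * 4 ^ N)
    (G : Finset ℕ) (hG : ∀ n ∈ candidates D (2 ^ N) s W, AvoidsFractions A j₀ j₁ ((n : ℝ) / D) →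
      n ∈ G) :
    W * 4 ^ N / (32 * N) ≤ G.card := by
  classical
  have hW : 0 < W := by by_contra h; push Not at h; nlinarith [pow_pos (two_pos (α := ℝ)) N]
  have hNR : (16 : ℝ) ≤ N := by exact_mod_cast hN
  have hA16 : 16 ≤ A := by nlinarith
  have hM0 : 0 < 2 ^ N := by positivity
  have h4 : ((2 : ℝ) ^ N) ^ 2 = 4 ^ N := by rw [← pow_mul, mul_comm, pow_mul]; norm_num
  set Y := candidates D (2 ^ N) s W with hY
  let Bad : ℕ → Finset ℕ := fun j => Y.filter (fun n => ∃ t : ℕ, 2 ^ j ≤ t ∧ t < 2 ^ (j + 1) ∧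
    ∃ p : ℤ, |(n : ℝ) / D - (p : ℝ) / t| < 2 / (A * (t : ℝ) ^ 2))
  have hsub : Y ⊆ G ∪ (Finset.Ico j₀ j₁).biUnion Bad := by
    intro n hn
    rw [Finset.mem_union]
    by_cases hav : AvoidsFractions A j₀ j₁ ((n : ℝ) / D)
    · exact Or.inl (hG n hn hav)
    · right
      simp only [AvoidsFractions] at hav
      push Not at hav
      obtain ⟨t, ht0, ht1, p, hp⟩ := hav
      have htpos : t ≠ 0 := by have : 0 < 2 ^ j₀ := by positivity
                               omega
      refine Finset.mem_biUnion.2 ⟨Nat.log 2 t, ?_, ?_⟩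
      · rw [Finset.mem_Ico]
        exact ⟨(Nat.le_log_iff_pow_le (by norm_num) htpos).2 ht0,
          (Nat.log_lt_iff_lt_pow (by norm_num) htpos).2 ht1⟩
      · simp only [Bad, Finset.mem_filter]
        exact ⟨hn, t, Nat.pow_log_le_self 2 htpos, Nat.lt_pow_succ_log_self (by norm_num) t, p, hp⟩
  have hX : W * 4 ^ N / (128 * N ^ 2) * 4 = W * 4 ^ N / (32 * N ^ 2) := by
    field_simp; norm_num
  have hBad : ∀ j ∈ Finset.Ico j₀ j₁, ((Bad j).card : ℝ) ≤ W * 4 ^ N / (32 * N ^ 2) := by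
    intro j hjm
    rw [Finset.mem_Ico] at hjm
    refine (card_candidates_near_le (j := j) (A := A) hM0 hD ?_ hW hA16 (Bad j)
      (Finset.filter_subset _ _) fun n hn => (Finset.mem_filter.1 hn).2).trans ?_
    · intro n hn
      exact (hdvd _ hn).1 (reducedDen_dvd n)
    · push_cast
      rw [h4, ← hX]
      -- Each of the four terms of the product is at most a quarter of the target, and each uses its
      -- own hypothesis: `hA`, `hj₁`, `hj₀` and `hWN` respectively.
      have e : (4 * W * 4 ^ j + 2) * (16 * 4 ^ N / (A * 4 ^ j) + 1)
          = 64 * W * 4 ^ N / A + 4 * W * 4 ^ j + 32 * 4 ^ N / (A * 4 ^ j) + 2 := by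
        field_simp
        ring
      rw [e]
      have t1 : 64 * W * 4 ^ N / A ≤ W * 4 ^ N / (128 * N ^ 2) := by
        rw [div_le_div_iff₀ (by positivity) (by positivity)]
        have : 64 * (128 * (N : ℝ) ^ 2) ≤ A := by nlinarith
        calc 64 * W * 4 ^ N * (128 * (N : ℝ) ^ 2) = W * 4 ^ N * (64 * (128 * (N : ℝ) ^ 2)) := by ring
          _ ≤ _ := by gcongr
      have t2 : 4 * W * 4 ^ j ≤ W * 4 ^ N / (128 * N ^ 2) := by
        rw [le_div_iff₀ (by positivity)]
        have h1 : (2 : ℝ) ^ j * A ≤ 2 ^ N :=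
          le_trans (by gcongr; norm_num; exact hjm.2.le) hj₁
        have h2 : (4 : ℝ) ^ j * A ^ 2 ≤ 4 ^ N := by
          calc (4 : ℝ) ^ j * A ^ 2 = (2 ^ j * A) ^ 2 := by
                rw [mul_pow, ← pow_mul, mul_comm j 2, pow_mul]; norm_num
            _ ≤ (2 ^ N) ^ 2 := by gcongr
            _ = 4 ^ N := h4
        have h3 : 512 * (N : ℝ) ^ 2 ≤ A ^ 2 := by nlinarith
        calc 4 * W * 4 ^ j * (128 * (N : ℝ) ^ 2) = W * (4 ^ j * (512 * (N : ℝ) ^ 2)) := by ring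
          _ ≤ W * (4 ^ j * A ^ 2) := by gcongr
          _ ≤ W * 4 ^ N := by gcongr
      have t3 : 32 * 4 ^ N / (A * 4 ^ j) ≤ W * 4 ^ N / (128 * N ^ 2) := by
        rw [div_le_div_iff₀ (by positivity) (by positivity)]
        have h1 : A * 4 ^ j₀ * W ≤ A * 4 ^ j * W := by
          gcongr; norm_num; exact hjm.1
        calc 32 * 4 ^ N * (128 * (N : ℝ) ^ 2) = 4 ^ N * (2 ^ 12 * (N : ℝ) ^ 2) := by ring
          _ ≤ 4 ^ N * (A * 4 ^ j * W) :=
            mul_le_mul_of_nonneg_left (hj₀.trans h1) (by positivity)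
          _ = _ := by ring
      have t4 : 2 ≤ W * 4 ^ N / (128 * N ^ 2) := by
        rw [le_div_iff₀ (by positivity)]
        linarith
      linarith
  -- There are at most `N` dyadic ranges, so at most `W 4 ^ N / (32 N)` candidates are bad, which is
  -- half of the lower bound `hY2` for the total.
  have hcard : (Y.card : ℝ) ≤ G.card + N * (W * 4 ^ N / (32 * N ^ 2)) := by
    have h1 : Y.card ≤ G.card + ∑ j ∈ Finset.Ico j₀ j₁, (Bad j).card :=
      (Finset.card_le_card hsub).trans ((Finset.card_union_le _ _).trans
        (by gcongr; exact Finset.card_biUnion_le))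
    have h2 : ((∑ j ∈ Finset.Ico j₀ j₁, (Bad j).card : ℕ) : ℝ)
        ≤ N * (W * 4 ^ N / (32 * N ^ 2)) := by
      push_cast
      refine (Finset.sum_le_card_nsmul _ _ _ hBad).trans ?_
      rw [nsmul_eq_mul, Nat.card_Ico]
      gcongr
      omega
    calc (Y.card : ℝ) ≤ ((G.card + ∑ j ∈ Finset.Ico j₀ j₁, (Bad j).card : ℕ) : ℝ) := by
          exact_mod_cast h1
      _ ≤ _ := by rw [Nat.cast_add]; gcongr
  have hYc := card_primes_mul_le_card_candidates (D := D) (M := 2 ^ N) (s := s) (W := W) hM0 hD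
    (fun q hq hq2 => (hdvd q hq).2 hq2) hs hsW (by push_cast; exact hMW)
  have hpr := two_pow_le_mul_card_primes hN
  set π := ((Finset.Ioo (2 ^ N) (2 * 2 ^ N)).filter Nat.Prime).card
  have hpr' : (2 : ℝ) ^ N ≤ 8 * N * π := by exact_mod_cast hpr
  push_cast at hYc
  have hY2 : W * 4 ^ N / (16 * N) ≤ Y.card := by
    refine le_trans ?_ hYc
    rw [div_le_iff₀ (by positivity), ← h4]
    calc W * (2 ^ N) ^ 2 = 2 ^ N * (2 ^ N * W) := by ring
      _ ≤ (8 * N * π) * (2 ^ N * W) := by gcongr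
      _ = _ := by ring
  have e1 : (N : ℝ) * (W * 4 ^ N / (32 * N ^ 2)) = W * 4 ^ N / (32 * N) := by field_simp
  have e2 : W * 4 ^ N / (16 * N) = W * 4 ^ N / (32 * N) + W * 4 ^ N / (32 * N) := by
    field_simp; norm_num
  linarith

/-! ### Parameters of the construction, and room for enough children. -/

namespace JarnikConstruction

/-- The base-two logarithm of the growth rate of the scales. -/
def rate (B : ℕ) : ℕ := 2 * B + 20

/-- The base-two logarithm of `M k`. -/
def scale (B k : ℕ) : ℕ := k * 2 ^ (rate B * k)

/-- The base-two logarithm of `M k ^ b k`. -/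
def expo (B : ℕ) (u : ℕ → ℕ) (k : ℕ) : ℕ := u k * 2 ^ (rate B * k)

/-- The slack per level in the distance to fractions with smaller denominators. -/
def slack (B : ℕ) : ℕ := 2 * rate B + B + 20

/-- A common denominator for all the centres of level `k`. -/
def commonDen (B k : ℕ) : ℕ := (2 * 2 ^ scale B k - 1).factorial

/-- The branching numbers. -/
def branch (B : ℕ) (u : ℕ → ℕ) (k : ℕ) : ℕ :=
  2 ^ (2 * scale B k - expo B u (k - 1) - rate B * k - (B + 7)) / k

/-- The fraction `n / D'` may be chosen as a centre inside the interval with centre `a / D` and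
radius at least `2 ^ (-E)`, and keeps away from fractions with denominators in `[2 ^ j₀, 2 ^ j₁)`. -/
def GoodChild (D D' M E j₀ j₁ A a n : ℕ) : Prop :=
  n < D' ∧ (reducedDen D' n).Prime ∧ M < reducedDen D' n ∧
  (a * 2 ^ (E + 1) + D) * D' < n * D * 2 ^ (E + 1) ∧
  n * D * 2 ^ (E + 2) ≤ (a * 2 ^ (E + 2) + 3 * D) * D' ∧
  ∀ t < 2 ^ j₁, 2 ^ j₀ ≤ t →
    2 * D' ≤ (n * t % D') * A * t ∧ 2 * D' ≤ (D' - n * t % D') * A * t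

open Classical in
/-- The list of the good children, in increasing order. -/
noncomputable def goodChildren (D D' M E j₀ j₁ A a : ℕ) : List ℕ :=
  (List.range D').filter (fun n => GoodChild D D' M E j₀ j₁ A a n)

/-- The numerators, over the common denominator of level `k + 1`, of the admissible centres of
level `k + 1` inside the interval of level `k` with centre `a / commonDen B k`. -/
noncomputable def children (B : ℕ) (u : ℕ → ℕ) (k a : ℕ) : List ℕ :=
  goodChildren (commonDen B k) (commonDen B (k + 1)) (2 ^ scale B (k + 1)) (expo B u k + B)
    -- Denominators below the first threshold are left to the earlier levels, where the gap `1 / (q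
    -- t)` to the parent's centre dominates its radius. Denominators above the second are controlled
    -- by the gap to the new centre itself.
    (expo B u k - scale B k - 2) (scale B (k + 1) - slack B * (k + 1)) (2 ^ (slack B * (k + 1))) a

/-- The numerator of the centre of the `i`-th interval of level `k`, over the common denominator
of level `k`. -/
noncomputable def node (B : ℕ) (u : ℕ → ℕ) : ℕ → ℕ → ℕ
  | 0, _ => 0
  | k + 1, i => (children B u k (node B u k (i / branch B u (k + 1)))).getD
      (i % branch B u (k + 1)) 0

/-- The data of the construction. -/
noncomputable def data (B : ℕ) (u : ℕ → ℕ) : JarnikData where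
  m := branch B u
  M k := 2 ^ scale B k
  -- The denominator is `k` for `k ≥ 1` and `1` for `k = 0`, in the shape that `IsComputableRatSeq`
  -- asks for.
  b k := (u k : ℚ) / (((k - 1 : ℕ) : ℚ) + 1)
  p k i := reducedNum (commonDen B k) (node B u k i)
  q k i := reducedDen (commonDen B k) (node B u k i)

/-- The centre of the `i`-th interval of level `k`. -/
noncomputable def centre (B : ℕ) (u : ℕ → ℕ) (k i : ℕ) : ℝ :=
  (node B u k i : ℝ) / commonDen B k

/-- The exponents `u k / k` are greater than `2` and at most `B`. -/
structure Admissible (B : ℕ) (u : ℕ → ℕ) : Prop where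
  le : ∀ k, u k ≤ B * k
  lt : ∀ k, 1 ≤ k → 2 * k < u k

theorem commonDen_pos (B k : ℕ) : 0 < commonDen B k := Nat.factorial_pos _

/-- The reason for taking a factorial as common denominator: a prime reduced denominator is
automatically below `2 M`. -/
theorem prime_dvd_commonDen_iff {B k q : ℕ} (hq : q.Prime) :
    q ∣ commonDen B k ↔ q < 2 * 2 ^ scale B k := by
  rw [commonDen, hq.dvd_factorial]
  have : 0 < 2 ^ scale B k := by positivity
  omega

theorem two_le_two_pow_rate (B : ℕ) : B + slack B ≤ 2 ^ rate B := by
  have h : ∀ n, 4 ≤ n → 4 * n ≤ 2 ^ n := by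
    intro n hn
    induction n, hn using Nat.le_induction with
    | base => norm_num
    | succ n hn ih => rw [pow_succ]; omega
  have := h (rate B) (by unfold rate; omega)
  unfold slack
  have h2 : rate B = 2 * B + 20 := rfl
  omega

variable {B : ℕ} {u : ℕ → ℕ}

theorem expo_le (h : Admissible B u) (k : ℕ) : expo B u k ≤ B * scale B k := by
  unfold expo scale
  calc u k * 2 ^ (rate B * k) ≤ (B * k) * 2 ^ (rate B * k) := Nat.mul_le_mul_right _ (h.le k)
    _ = _ := by ring

theorem two_mul_scale_le_expo (h : Admissible B u) (k : ℕ) : 2 * scale B k ≤ expo B u k := by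
  unfold expo scale
  have : 2 * k ≤ u k := by
    rcases Nat.eq_zero_or_pos k with rfl | hk
    · simp
    · exact (h.lt k hk).le
  calc 2 * (k * 2 ^ (rate B * k)) = (2 * k) * 2 ^ (rate B * k) := by ring
    _ ≤ _ := Nat.mul_le_mul_right _ this

theorem two_mul_scale_add_le_expo (h : Admissible B u) {k : ℕ} (hk : 1 ≤ k) :
    2 * scale B k + 4 ≤ expo B u k := by
  unfold expo scale
  have h1 : 2 * k + 1 ≤ u k := h.lt k hk
  have h2 : 4 ≤ 2 ^ (rate B * k) := by
    calc 4 = 2 ^ 2 := by norm_num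
      _ ≤ 2 ^ (rate B * k) := Nat.pow_le_pow_right (by norm_num) (by unfold rate; nlinarith)
  calc 2 * (k * 2 ^ (rate B * k)) + 4 ≤ 2 * (k * 2 ^ (rate B * k)) + 2 ^ (rate B * k) := by gcongr
    _ = (2 * k + 1) * 2 ^ (rate B * k) := by ring
    _ ≤ _ := Nat.mul_le_mul_right _ h1

/-- `scale` gains a factor of at least `2 ^ rate B` per level, chosen to exceed `B + slack B`. Hence
`M_{k+1}` outgrows `M_k ^ b_k` even after multiplication by `2 ^ (slack B * (k + 1))`. -/
theorem expo_add_le_scale_succ (h : Admissible B u) (k : ℕ) :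
    expo B u k + slack B * (k + 1) ≤ scale B (k + 1) := by
  have h1 := expo_le h k
  have h2 := two_le_two_pow_rate B
  have h3 : 1 ≤ 2 ^ (rate B * k) := Nat.one_le_two_pow
  unfold scale at h1 ⊢
  calc expo B u k + slack B * (k + 1)
      ≤ B * (k * 2 ^ (rate B * k)) + slack B * (k + 1) * 2 ^ (rate B * k) :=
        Nat.add_le_add h1 (Nat.le_mul_of_pos_right _ h3)
    _ ≤ B * ((k + 1) * 2 ^ (rate B * k)) + slack B * (k + 1) * 2 ^ (rate B * k) := by
        gcongr; omega
    _ = (k + 1) * ((B + slack B) * 2 ^ (rate B * k)) := by ring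
    _ ≤ (k + 1) * (2 ^ rate B * 2 ^ (rate B * k)) := by gcongr
    _ = _ := by rw [← pow_add]; congr 2; ring

theorem scale_le_two_pow (B k : ℕ) : scale B k ≤ 2 ^ ((rate B + 1) * k) := by
  unfold scale
  calc k * 2 ^ (rate B * k) ≤ 2 ^ k * 2 ^ (rate B * k) :=
        Nat.mul_le_mul_right _ Nat.lt_two_pow_self.le
    _ = _ := by rw [← pow_add]; congr 1; ring

theorem le_slack_mul (B k : ℕ) : 2 * rate B * (k + 1) + B + k + 20 ≤ slack B * (k + 1) := by
  unfold slack
  nlinarith [Nat.zero_le (B * k)]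

/-- The logarithm `scale B (k + 1)` of `M_{k+1}` is itself only exponential in `k`. A slack linear
in `k` therefore pays for its square, while remaining negligible against `scale`. -/
theorem two_mul_rate_add_le_slack (B k : ℕ) :
    2 * rate B * (k + 1) + 2 * (k + 1) + (B + 18) ≤ slack B * (k + 1) := by
  unfold slack
  nlinarith [Nat.zero_le (B * k)]

theorem scale_succ_cast (B k : ℕ) :
    (scale B (k + 1) : ℝ) = (k + 1) * 2 ^ (rate B * (k + 1)) := by
  unfold scale; push_cast; ring

attribute [irreducible] rate scale expo slack

/-- The condition for a single denominator in `GoodChild`. -/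
theorem forall_le_abs_sub_iff {D n t A : ℕ} (hD : 0 < D) (ht : 0 < t) (hA : 0 < A) :
    (∀ p : ℤ, 2 / ((A : ℝ) * (t : ℝ) ^ 2) ≤ |(n : ℝ) / D - (p : ℝ) / t|) ↔
      2 * D ≤ (n * t % D) * A * t ∧ 2 * D ≤ (D - n * t % D) * A * t := by
  have hDR : (0 : ℝ) < D := by exact_mod_cast hD
  have htR : (0 : ℝ) < t := by exact_mod_cast ht
  have hAR : (0 : ℝ) < A := by exact_mod_cast hA
  have key : ∀ p : ℤ, 2 / ((A : ℝ) * (t : ℝ) ^ 2) ≤ |(n : ℝ) / D - (p : ℝ) / t| ↔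
      2 * (D : ℤ) ≤ |(n : ℤ) * t - p * D| * (A * t) := by
    intro p
    rw [div_sub_div _ _ hDR.ne' htR.ne', abs_div, abs_of_pos (mul_pos hDR htR),
      div_le_div_iff₀ (by positivity) (by positivity)]
    rw [← Int.cast_le (R := ℝ)]
    push_cast
    rw [show (2 : ℝ) * (D * t) = (2 * D) * t by ring,
      show |(n : ℝ) * t - D * p| * (A * (t : ℝ) ^ 2) = (|(n : ℝ) * t - p * D| * (A * t)) * t by
        rw [mul_comm (D : ℝ)]; ring]
    exact mul_le_mul_iff_left₀ htR
  set r := n * t % D with hr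
  have hrD : r < D := Nat.mod_lt _ hD
  have hdiv : ((n : ℤ) * t) = D * ((n * t / D : ℕ) : ℤ) + r := by
    have := Nat.div_add_mod (n * t) D
    exact_mod_cast this.symm
  simp only [key]
  constructor
  · intro H
    -- Only the two integers adjacent to `n t / D` matter, which turns the quantifier over all `p`
    -- into a decidable condition on a remainder.
    have h1 := H ((n * t / D : ℕ) : ℤ)
    have h2 := H (((n * t / D : ℕ) : ℤ) + 1)
    rw [hdiv, show (D : ℤ) * ((n * t / D : ℕ) : ℤ) + r - ((n * t / D : ℕ) : ℤ) * D = (r : ℤ) by ring,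
      abs_of_nonneg (by positivity)] at h1
    rw [hdiv, show (D : ℤ) * ((n * t / D : ℕ) : ℤ) + r - (((n * t / D : ℕ) : ℤ) + 1) * D
      = -((D - r : ℕ) : ℤ) by rw [Nat.cast_sub hrD.le]; ring, abs_neg,
      abs_of_nonneg (by positivity)] at h2
    rw [← mul_assoc] at h1 h2
    exact ⟨by exact_mod_cast h1, by exact_mod_cast h2⟩
  · rintro ⟨h1, h2⟩ p
    have h1' : 2 * (D : ℤ) ≤ r * (A * t) := by rw [← mul_assoc]; exact_mod_cast h1
    have h2' : 2 * (D : ℤ) ≤ ((D - r : ℕ) : ℤ) * (A * t) := by rw [← mul_assoc]; exact_mod_cast h2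
    rw [Nat.cast_sub hrD.le] at h2'
    rw [hdiv]
    have hrD' : (r : ℤ) < D := by exact_mod_cast hrD
    have hAt : (0 : ℤ) ≤ A * t := by positivity
    have hDZ : (0 : ℤ) < D := by exact_mod_cast hD
    rcases le_or_gt p ((n * t / D : ℕ) : ℤ) with hp | hp
    · refine h1'.trans (mul_le_mul_of_nonneg_right ?_ hAt)
      refine le_trans ?_ (le_abs_self _)
      nlinarith
    · refine h2'.trans (mul_le_mul_of_nonneg_right ?_ hAt)
      refine le_trans ?_ (neg_le_abs _)
      have : ((n * t / D : ℕ) : ℤ) + 1 ≤ p := hp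
      nlinarith

theorem goodChild_iff {D D' M E j₀ j₁ A a n : ℕ} (hD : 0 < D) (hD' : 0 < D') (hA : 0 < A) :
    GoodChild D D' M E j₀ j₁ A a n ↔
      n ∈ candidates D' M ((a : ℝ) / D + 1 / 2 ^ (E + 1)) (1 / 2 ^ (E + 2)) ∧
        AvoidsFractions A j₀ j₁ ((n : ℝ) / D') := by
  have hDR : (0 : ℝ) < D := by exact_mod_cast hD
  have hDR' : (0 : ℝ) < D' := by exact_mod_cast hD'
  have h1 : (a : ℝ) / D + 1 / 2 ^ (E + 1) < (n : ℝ) / D' ↔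
      (a * 2 ^ (E + 1) + D) * D' < n * D * 2 ^ (E + 1) := by
    rw [div_add_div _ _ hDR.ne' (by positivity), div_lt_div_iff₀ (by positivity) hDR', mul_one,
      ← mul_assoc]
    exact_mod_cast Iff.rfl
  have h2 : (n : ℝ) / D' ≤ (a : ℝ) / D + 1 / 2 ^ (E + 1) + 1 / 2 ^ (E + 2) ↔
      n * D * 2 ^ (E + 2) ≤ (a * 2 ^ (E + 2) + 3 * D) * D' := by
    have : (a : ℝ) / D + 1 / 2 ^ (E + 1) + 1 / 2 ^ (E + 2)
        = ((a : ℝ) * 2 ^ (E + 2) + 3 * D) / (D * 2 ^ (E + 2)) := by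
      field_simp
      ring
    rw [this, div_le_div_iff₀ hDR' (by positivity), ← mul_assoc]
    exact_mod_cast Iff.rfl
  rw [GoodChild, mem_candidates, AvoidsFractions, h1, h2]
  have h3 : (∀ t < 2 ^ j₁, 2 ^ j₀ ≤ t →
      2 * D' ≤ (n * t % D') * A * t ∧ 2 * D' ≤ (D' - n * t % D') * A * t) ↔
      ∀ t : ℕ, 2 ^ j₀ ≤ t → t < 2 ^ j₁ → ∀ p : ℤ,
        2 / ((A : ℝ) * (t : ℝ) ^ 2) ≤ |(n : ℝ) / D' - (p : ℝ) / t| := by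
    have h4 : ∀ t, 2 ^ j₀ ≤ t → 0 < t := fun t ht => lt_of_lt_of_le (by positivity) ht
    exact ⟨fun H t a b => (forall_le_abs_sub_iff hD' (h4 t a) hA).2 (H t b a),
      fun H t b a => (forall_le_abs_sub_iff hD' (h4 t a) hA).1 (H t a b)⟩
  rw [h3]
  tauto

theorem mem_children {k a n : ℕ} : n ∈ children B u k a ↔
    n ∈ candidates (commonDen B (k + 1)) (2 ^ scale B (k + 1))
        ((a : ℝ) / commonDen B k + 1 / 2 ^ (expo B u k + B + 1)) (1 / 2 ^ (expo B u k + B + 2)) ∧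
      AvoidsFractions (2 ^ (slack B * (k + 1))) (expo B u k - scale B k - 2)
        (scale B (k + 1) - slack B * (k + 1)) ((n : ℝ) / commonDen B (k + 1)) := by
  have := goodChild_iff (M := 2 ^ scale B (k + 1)) (E := expo B u k + B) (n := n) (a := a)
    (j₀ := expo B u k - scale B k - 2) (j₁ := scale B (k + 1) - slack B * (k + 1))
    (commonDen_pos B k) (commonDen_pos B (k + 1))
    (show 0 < 2 ^ (slack B * (k + 1)) by positivity)
  push_cast at this
  rw [← this, children, goodChildren]
  simp only [List.mem_filter, List.mem_range, decide_eq_true_eq]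
  exact ⟨fun h => h.2, fun h => ⟨h.1, h⟩⟩

theorem pairwise_children (k a : ℕ) : (children B u k a).Pairwise (· < ·) :=
  List.Pairwise.filter _ List.pairwise_lt_range

/-- In `branch`, the constant `2 ^ (B + 7)` is `2 ^ (B + 2)` from the width of the window times the
`32` of the counting bound. Dividing by `2 ^ (rate B * k)` and by `k` amounts to dividing by `scale
B k`, the base-two logarithm of `M_k`. -/
theorem branch_succ_le (h : Admissible B u) (k : ℕ) :
    (branch B u (k + 1) : ℝ) ≤
      1 / 2 ^ (expo B u k + B + 2) * 4 ^ scale B (k + 1) / (32 * scale B (k + 1)) := by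
  have hE := expo_add_le_scale_succ h k
  have hS := le_slack_mul B k
  have h1 : rate B * (k + 1) ≤ 2 * rate B * (k + 1) := by nlinarith [Nat.zero_le (rate B * (k + 1))]
  obtain ⟨e, he⟩ : ∃ e, 2 * scale B (k + 1) = e + expo B u k + rate B * (k + 1) + (B + 7) :=
    ⟨2 * scale B (k + 1) - expo B u k - rate B * (k + 1) - (B + 7), by omega⟩
  have hb : branch B u (k + 1) = 2 ^ e / (k + 1) := by
    rw [branch, Nat.add_sub_cancel, he]; congr 2; omega
  rw [hb]
  refine Nat.cast_div_le.trans (le_of_eq ?_)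
  have h4 : (4 : ℝ) ^ scale B (k + 1) = 2 ^ e * 2 ^ expo B u k * 2 ^ (rate B * (k + 1)) *
      (2 ^ B * 2 ^ 7) := by
    rw [← pow_add, ← pow_add, ← pow_add, ← pow_add, ← he, pow_mul]; norm_num
  have h5 := scale_succ_cast B k
  rw [h4, h5]
  have hk : (0 : ℝ) < k + 1 := by positivity
  have h6 : (2 : ℝ) ^ (expo B u k + B + 2) = 2 ^ expo B u k * 2 ^ B * 4 := by
    rw [pow_add, pow_add]; norm_num
  rw [h6]
  push_cast
  field_simp
  norm_num

/-- Every interval has room for enough admissible intervals of the next level. -/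
theorem branch_le_length_children (h : Admissible B u) {k a : ℕ}
    (ha : (a : ℝ) / commonDen B k + 1 / 2 ^ (expo B u k + B) ≤ 1) :
    branch B u (k + 1) ≤ (children B u k a).length := by
  have hE := expo_add_le_scale_succ h k
  have hS := le_slack_mul B k
  have h2 := two_mul_scale_le_expo h k
  have h3 := scale_le_two_pow B (k + 1)
  have h1 : rate B * (k + 1) ≤ 2 * rate B * (k + 1) := by nlinarith [Nat.zero_le (rate B * (k + 1))]
  have hN2 : (scale B (k + 1) : ℝ) ^ 2 ≤ 2 ^ (2 * rate B * (k + 1) + 2 * (k + 1)) := by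
    have : (scale B (k + 1) : ℝ) ≤ 2 ^ ((rate B + 1) * (k + 1)) := by exact_mod_cast h3
    calc (scale B (k + 1) : ℝ) ^ 2 ≤ (2 ^ ((rate B + 1) * (k + 1))) ^ 2 := by gcongr
      _ = _ := by rw [← pow_mul]; congr 1; ring
  have hS2 : 2 * rate B * (k + 1) + 2 * (k + 1) + (B + 18) ≤ slack B * (k + 1) := by
    exact two_mul_rate_add_le_slack B k
  have h4 : (4 : ℝ) ^ scale B (k + 1) = 2 ^ (2 * scale B (k + 1)) := by rw [pow_mul]; norm_num
  have hbound : ((children B u k a).toFinset.card : ℝ) ≥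
      1 / 2 ^ (expo B u k + B + 2) * 4 ^ scale B (k + 1) / (32 * scale B (k + 1)) := by
    refine le_card_candidates_avoiding (D := commonDen B (k + 1)) (N := scale B (k + 1))
      (j₀ := expo B u k - scale B k - 2) (j₁ := scale B (k + 1) - slack B * (k + 1))
      (s := (a : ℝ) / commonDen B k + 1 / 2 ^ (expo B u k + B + 1))
      (A := 2 ^ (slack B * (k + 1)))
      (commonDen_pos _ _) (by omega) (fun q hq => prime_dvd_commonDen_iff hq) (by positivity)
      ?_ ?_ (Nat.sub_le _ _) ?_ ?_ ?_ ?_ _ ?_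
    · have e : (1 : ℝ) / 2 ^ (expo B u k + B + 1) + 1 / 2 ^ (expo B u k + B + 2)
          < 1 / 2 ^ (expo B u k + B) := by
        have hp : (0 : ℝ) < 1 / 2 ^ (expo B u k + B) := by positivity
        have e1 : (1 : ℝ) / 2 ^ (expo B u k + B + 1) = 1 / 2 ^ (expo B u k + B) / 2 := by
          rw [pow_succ]; field_simp
        have e2 : (1 : ℝ) / 2 ^ (expo B u k + B + 2) = 1 / 2 ^ (expo B u k + B) / 4 := by
          rw [pow_add]; field_simp; norm_num
        rw [e1, e2]; linarith
      linarith
    · rw [mul_one_div, le_div_iff₀ (by positivity), ← pow_succ']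
      exact pow_le_pow_right₀ (by norm_num) (by omega)
    · calc (2 : ℝ) ^ 13 * (scale B (k + 1) : ℝ) ^ 2
          ≤ 2 ^ 13 * 2 ^ (2 * rate B * (k + 1) + 2 * (k + 1)) := by gcongr
        _ = 2 ^ (13 + (2 * rate B * (k + 1) + 2 * (k + 1))) := by rw [pow_add _ 13]
        _ ≤ _ := pow_le_pow_right₀ (by norm_num) (by omega)
    · rw [← pow_add]
      exact pow_le_pow_right₀ (by norm_num) (by omega)
    -- Since the exponents are at least `2`, `4 ^ j₀` makes up for the width of the window up to the
    -- factor `2 ^ (B + 6)`, which the slack covers.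
    · rw [mul_one_div, le_div_iff₀ (by positivity)]
      have h44 : (4 : ℝ) ^ (expo B u k - scale B k - 2) = 2 ^ (2 * (expo B u k - scale B k - 2)) := by
        rw [pow_mul]; norm_num
      rw [h44]
      calc (2 : ℝ) ^ 12 * (scale B (k + 1) : ℝ) ^ 2 * 2 ^ (expo B u k + B + 2)
          ≤ 2 ^ 12 * 2 ^ (2 * rate B * (k + 1) + 2 * (k + 1)) * 2 ^ (expo B u k + B + 2) := by gcongr
        _ = 2 ^ (12 + (2 * rate B * (k + 1) + 2 * (k + 1)) + (expo B u k + B + 2)) := by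
            rw [pow_add _ (12 + _), pow_add _ 12]
        _ ≤ 2 ^ (slack B * (k + 1) + 2 * (expo B u k - scale B k - 2)) :=
            pow_le_pow_right₀ (by norm_num) (by omega)
        _ = _ := by rw [pow_add]
    · rw [one_div_mul_eq_div, le_div_iff₀ (by positivity), h4]
      calc (256 : ℝ) * (scale B (k + 1) : ℝ) ^ 2 * 2 ^ (expo B u k + B + 2)
          ≤ 2 ^ 8 * 2 ^ (2 * rate B * (k + 1) + 2 * (k + 1)) * 2 ^ (expo B u k + B + 2) := by
            gcongr; norm_num
        _ = 2 ^ (8 + (2 * rate B * (k + 1) + 2 * (k + 1)) + (expo B u k + B + 2)) := by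
            rw [pow_add _ (8 + _), pow_add _ 8]
        _ ≤ _ := pow_le_pow_right₀ (by norm_num) (by omega)
    · intro n hn hav
      rw [List.mem_toFinset, mem_children]
      exact ⟨hn, hav⟩
  have hlen : (children B u k a).toFinset.card ≤ (children B u k a).length :=
    List.toFinset_card_le _
  have : (branch B u (k + 1) : ℝ) ≤ ((children B u k a).length : ℝ) :=
    (branch_succ_le h k).trans (hbound.le.trans (by exact_mod_cast hlen))
  exact_mod_cast this

end JarnikConstruction

/-! ### The construction is Cantor-like. -/

namespace JarnikConstruction

variable {B : ℕ} {u : ℕ → ℕ}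

/-- The subtractions in `branch` do not truncate, and the power of two leaves a quotient of at least
`2` after division by `k + 1`. -/
theorem exists_branch_eq (h : Admissible B u) (k : ℕ) :
    ∃ e, 2 * scale B (k + 1) = e + expo B u k + rate B * (k + 1) + (B + 7) ∧
      branch B u (k + 1) = 2 ^ e / (k + 1) ∧ 2 * (k + 1) ≤ 2 ^ e := by
  have hE := expo_add_le_scale_succ h k
  have hS := le_slack_mul B k
  have h1 : rate B * (k + 1) ≤ 2 * rate B * (k + 1) := by nlinarith [Nat.zero_le (rate B * (k + 1))]
  refine ⟨2 * scale B (k + 1) - expo B u k - rate B * (k + 1) - (B + 7), by omega, ?_, ?_⟩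
  · rw [branch, Nat.add_sub_cancel]
  · calc 2 * (k + 1) ≤ 2 * 2 ^ (k + 1) := by gcongr; exact Nat.lt_two_pow_self.le
      _ = 2 ^ (k + 2) := by ring
      _ ≤ _ := Nat.pow_le_pow_right (by norm_num) (by omega)

theorem two_le_branch_succ (h : Admissible B u) (k : ℕ) : 2 ≤ branch B u (k + 1) := by
  obtain ⟨e, -, hb, he⟩ := exists_branch_eq h k
  rw [hb, Nat.le_div_iff_mul_le (by omega)]
  exact he

theorem count_succ (k : ℕ) :
    (data B u).count (k + 1) = (data B u).count k * branch B u (k + 1) := by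
  rw [JarnikData.count, Finset.prod_range_succ]; rfl

theorem count_zero : (data B u).count 0 = 1 := by simp [JarnikData.count]

theorem count_pos (h : Admissible B u) (k : ℕ) : 0 < (data B u).count k := by
  induction k with
  | zero => simp [count_zero]
  | succ k ih =>
    rw [count_succ]
    exact Nat.mul_pos ih (by have := two_le_branch_succ h k; omega)

theorem div_branch_lt_count {k i : ℕ} (hi : i < (data B u).count (k + 1)) :
    i / branch B u (k + 1) < (data B u).count k := by
  rw [count_succ] at hi
  exact Nat.div_lt_of_lt_mul (by rwa [mul_comm])

theorem expo_add_two_le_expo_succ (h : Admissible B u) (k : ℕ) :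
    expo B u k + B + 2 ≤ expo B u (k + 1) := by
  have := expo_add_le_scale_succ h k
  have := le_slack_mul B k
  have := two_mul_scale_le_expo h (k + 1)
  omega

theorem scale_lt_scale_succ (h : Admissible B u) (k : ℕ) : scale B k < scale B (k + 1) := by
  have := expo_add_le_scale_succ h k
  have := le_slack_mul B k
  have := two_mul_scale_le_expo h k
  omega

theorem node_succ_mem_children (h : Admissible B u) {k i : ℕ}
    (hbd : centre B u k (i / branch B u (k + 1)) + 1 / 2 ^ (expo B u k + B) ≤ 1) :
    node B u (k + 1) i ∈ children B u k (node B u k (i / branch B u (k + 1))) := by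
  have hlen := branch_le_length_children h hbd
  have hm := two_le_branch_succ h k
  have hlt : i % branch B u (k + 1)
      < (children B u k (node B u k (i / branch B u (k + 1)))).length :=
    (Nat.mod_lt _ (by omega)).trans_le hlen
  rw [node, List.getD_eq_getElem _ _ hlt]
  exact List.getElem_mem _

/-- A child's centre is at most `3/4` of the guaranteed radius to the right of its parent's centre,
and its own guaranteed radius takes at most the remaining quarter. -/
theorem centre_add_le_one (h : Admissible B u) : ∀ k i, i < (data B u).count k →
    centre B u k i + 1 / 2 ^ (expo B u k + B) ≤ 1 := by
  intro k
  induction k with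
  | zero =>
    intro i _
    simp only [centre, node, Nat.cast_zero, zero_div, zero_add]
    rw [div_le_one (by positivity)]
    exact one_le_pow₀ (by norm_num)
  | succ k ih =>
    intro i hi
    have hbd := ih _ (div_branch_lt_count hi)
    have hmem := mem_children.1 (node_succ_mem_children h hbd)
    have h2 := (mem_candidates.1 hmem.1).2.2.2.2
    have hE := expo_add_two_le_expo_succ h k
    have h3 : (1 : ℝ) / 2 ^ (expo B u (k + 1) + B) ≤ 1 / 2 ^ (expo B u k + B + 2) := by
      apply one_div_le_one_div_of_le (by positivity)
      exact pow_le_pow_right₀ (by norm_num) (by omega)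
    have e1 : (1 : ℝ) / 2 ^ (expo B u k + B + 1) = 1 / 2 ^ (expo B u k + B) / 2 := by
      rw [pow_succ]; field_simp
    have e2 : (1 : ℝ) / 2 ^ (expo B u k + B + 2) = 1 / 2 ^ (expo B u k + B) / 4 := by
      rw [pow_add]; field_simp; norm_num
    change centre B u (k + 1) i ≤ centre B u k _ + _ + _ at h2
    rw [e1, e2] at h2
    rw [e2] at h3
    linarith

/-- The properties of the centre of an interval of level `k + 1` that come from its choice. -/
structure ChildSpec (B : ℕ) (u : ℕ → ℕ) (k i : ℕ) : Prop where
  prime : ((data B u).q (k + 1) i).Prime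
  lt_q : 2 ^ scale B (k + 1) < (data B u).q (k + 1) i
  q_lt : (data B u).q (k + 1) i < 2 * 2 ^ scale B (k + 1)
  lt_centre : centre B u k (i / branch B u (k + 1)) + 1 / 2 ^ (expo B u k + B) / 2
    < centre B u (k + 1) i
  centre_le : centre B u (k + 1) i ≤ centre B u k (i / branch B u (k + 1)) +
    1 / 2 ^ (expo B u k + B) * (3 / 4)
  avoids : AvoidsFractions (2 ^ (slack B * (k + 1))) (expo B u k - scale B k - 2)
    (scale B (k + 1) - slack B * (k + 1)) (centre B u (k + 1) i)

theorem childSpec (h : Admissible B u) {k i : ℕ} (hi : i < (data B u).count (k + 1)) :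
    ChildSpec B u k i := by
  have hmem := mem_children.1
    (node_succ_mem_children h (centre_add_le_one h _ _ (div_branch_lt_count hi)))
  obtain ⟨-, hp, hlt, h1, h2⟩ := mem_candidates.1 hmem.1
  have e1 : (1 : ℝ) / 2 ^ (expo B u k + B + 1) = 1 / 2 ^ (expo B u k + B) / 2 := by
    rw [pow_succ]; field_simp
  have e2 : (1 : ℝ) / 2 ^ (expo B u k + B + 2) = 1 / 2 ^ (expo B u k + B) / 4 := by
    rw [pow_add]; field_simp; norm_num
  rw [e1] at h1
  rw [e1, e2] at h2
  refine ⟨hp, hlt, (prime_dvd_commonDen_iff hp).1 (reducedDen_dvd _), h1, ?_, hmem.2⟩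
  change centre B u (k + 1) i ≤ centre B u k _ + _ + _ at h2
  linarith

theorem p_div_q (k i : ℕ) :
    ((data B u).p k i : ℝ) / (data B u).q k i = centre B u k i :=
  reducedNum_div_reducedDen (commonDen_pos B k) _

theorem data_b_succ (k : ℕ) : (((data B u).b (k + 1) : ℚ) : ℝ) = (u (k + 1) : ℝ) / (k + 1) := by
  simp [data]

/-- The factor `k` in `scale` cancels the denominator of `b k = u k / k`, so that `M_k ^ b_k` is an
exact power of two. -/
theorem two_pow_scale_rpow (k : ℕ) :
    ((2 : ℝ) ^ scale B (k + 1)) ^ ((u (k + 1) : ℝ) / (k + 1)) = 2 ^ expo B u (k + 1) := by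
  rw [← Real.rpow_natCast 2 (scale B (k + 1)), ← Real.rpow_mul (by norm_num), ← Real.rpow_natCast]
  congr 1
  rw [scale_succ_cast, expo]
  push_cast
  field_simp

/-- The radius of an interval of level `k + 1`. -/
noncomputable def radius (B : ℕ) (u : ℕ → ℕ) (k i : ℕ) : ℝ :=
  ((data B u).q (k + 1) i : ℝ) ^ (-((data B u).b (k + 1) : ℝ))

/-- Replacing `q < 2 M` by `M` costs at most `2 ^ b ≤ 2 ^ B`, which is where the `+ B` in the
exponents comes from. -/
theorem radius_bounds (h : Admissible B u) {k i : ℕ} (hi : i < (data B u).count (k + 1)) :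
    1 / 2 ^ (expo B u (k + 1) + B) ≤ radius B u k i ∧
      radius B u k i < 1 / 2 ^ expo B u (k + 1) := by
  have hs := childSpec h hi
  have hk : (0 : ℝ) < k + 1 := by positivity
  have hu : (0 : ℝ) < u (k + 1) := by
    have := h.lt (k + 1) (by omega)
    exact_mod_cast (by omega : 0 < u (k + 1))
  have hb : (0 : ℝ) < (u (k + 1) : ℝ) / (k + 1) := by positivity
  have hbB : (u (k + 1) : ℝ) / (k + 1) ≤ B := by
    rw [div_le_iff₀ hk]; exact_mod_cast h.le (k + 1)
  have h1 : (2 : ℝ) ^ scale B (k + 1) < (data B u).q (k + 1) i := by exact_mod_cast hs.lt_q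
  have h2 : ((data B u).q (k + 1) i : ℝ) ≤ 2 * 2 ^ scale B (k + 1) := by exact_mod_cast hs.q_lt.le
  have hq : (0 : ℝ) < (data B u).q (k + 1) i := lt_trans (by positivity) h1
  rw [radius, data_b_succ, Real.rpow_neg hq.le, ← one_div]
  constructor
  · apply one_div_le_one_div_of_le (Real.rpow_pos_of_pos hq _)
    calc ((data B u).q (k + 1) i : ℝ) ^ ((u (k + 1) : ℝ) / (k + 1))
        ≤ (2 * 2 ^ scale B (k + 1)) ^ ((u (k + 1) : ℝ) / (k + 1)) := by gcongr
      _ = 2 ^ ((u (k + 1) : ℝ) / (k + 1)) * 2 ^ expo B u (k + 1) := by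
          rw [Real.mul_rpow (by norm_num) (by positivity), two_pow_scale_rpow]
      _ ≤ 2 ^ (B : ℝ) * 2 ^ expo B u (k + 1) := by
          gcongr; norm_num
      _ = _ := by rw [Real.rpow_natCast, ← pow_add, add_comm]
  · apply one_div_lt_one_div_of_lt (by positivity)
    rw [← two_pow_scale_rpow]
    exact Real.rpow_lt_rpow (by positivity) h1 hb

theorem left_succ (k i : ℕ) :
    (data B u).left (k + 1) i = centre B u (k + 1) i - radius B u k i := by
  rw [JarnikData.left, p_div_q]; rfl

theorem right_succ (k i : ℕ) :
    (data B u).right (k + 1) i = centre B u (k + 1) i + radius B u k i := by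
  rw [JarnikData.right, p_div_q]; rfl

theorem centre_bounds (h : Admissible B u) {k i : ℕ} (hi : i < (data B u).count k) :
    (data B u).left k i ≤ centre B u k i ∧
      centre B u k i + 1 / 2 ^ (expo B u k + B) ≤ (data B u).right k i := by
  cases k with
  | zero =>
    have := centre_add_le_one h 0 i hi
    exact ⟨by simp [JarnikData.left, centre, node], this⟩
  | succ k =>
    have := radius_bounds h hi
    have h0 : (0 : ℝ) < 1 / 2 ^ (expo B u (k + 1) + B) := by positivity
    rw [left_succ, right_succ]
    constructor <;> linarith

/-- The intervals of level `k + 1` are well inside those of level `k`. -/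
theorem child_bounds (h : Admissible B u) {k i : ℕ} (hi : i < (data B u).count (k + 1)) :
    centre B u k (i / branch B u (k + 1)) + 1 / 2 ^ (expo B u k + B) / 4
        < (data B u).left (k + 1) i ∧
      (data B u).right (k + 1) i < (data B u).right k (i / branch B u (k + 1)) := by
  have hs := childSpec h hi
  have hr := radius_bounds h hi
  have hc := centre_bounds h (div_branch_lt_count hi)
  have hE := expo_add_two_le_expo_succ h k
  have h3 : (1 : ℝ) / 2 ^ expo B u (k + 1) ≤ 1 / 2 ^ (expo B u k + B + 2) := by
    apply one_div_le_one_div_of_le (by positivity)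
    exact pow_le_pow_right₀ (by norm_num) (by omega)
  have e2 : (1 : ℝ) / 2 ^ (expo B u k + B + 2) = 1 / 2 ^ (expo B u k + B) / 4 := by
    rw [pow_add]; field_simp; norm_num
  rw [e2] at h3
  have h4 := hs.lt_centre
  have h5 := hs.centre_le
  rw [left_succ, right_succ]
  constructor <;> linarith

theorem interval_subset (h : Admissible B u) {k i : ℕ} (hi : i < (data B u).count (k + 1)) :
    (data B u).interval (k + 1) i ⊆
      Set.Ioo ((data B u).left k (i / branch B u (k + 1)))
        ((data B u).right k (i / branch B u (k + 1))) := by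
  have h1 := child_bounds h hi
  have h2 := centre_bounds h (div_branch_lt_count hi)
  have h0 : (0 : ℝ) < 1 / 2 ^ (expo B u k + B) / 4 := by positivity
  intro x hx
  exact ⟨by linarith [hx.1], by linarith [hx.2]⟩

/-- The centres are `1 / (4 M²)` apart and each radius is at most `1 / (16 M²)`, because `u` is an
integer greater than twice the level; `1/4 - 2/16 = 1/8`. -/
theorem gap_of_siblings (h : Admissible B u) {k i : ℕ} (hi : i + 1 < (data B u).count (k + 1))
    (hpar : (i + 1) / branch B u (k + 1) = i / branch B u (k + 1)) :
    (data B u).right (k + 1) i + 1 / (8 * ((2 : ℝ) ^ scale B (k + 1)) ^ 2)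
      ≤ (data B u).left (k + 1) (i + 1) := by
  have hi' : i < (data B u).count (k + 1) := by omega
  have hm := two_le_branch_succ h k
  have hbd := centre_add_le_one h _ _ (div_branch_lt_count hi')
  have hlen := branch_le_length_children h hbd
  have hmod : (i + 1) % branch B u (k + 1) = i % branch B u (k + 1) + 1 := by
    have h1 := Nat.div_add_mod i (branch B u (k + 1))
    have h2 := Nat.div_add_mod (i + 1) (branch B u (k + 1))
    rw [hpar] at h2
    omega
  have hmlt : (i + 1) % branch B u (k + 1) < branch B u (k + 1) := Nat.mod_lt _ (by omega)
  have hlt : node B u (k + 1) i < node B u (k + 1) (i + 1) := by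
    rw [node, node, hpar, hmod, List.getD_eq_getElem _ _ (by omega),
      List.getD_eq_getElem _ _ (by omega)]
    exact List.pairwise_iff_getElem.1 (pairwise_children k _) _ _ _ _ (Nat.lt_succ_self _)
  have hs := childSpec h hi
  have hs' := childSpec h hi'
  have hD : (0 : ℝ) < commonDen B (k + 1) := by exact_mod_cast commonDen_pos B (k + 1)
  have hsep : 1 / (4 * ((2 ^ scale B (k + 1) : ℕ) : ℝ) ^ 2) ≤
      |centre B u (k + 1) (i + 1) - centre B u (k + 1) i| :=
    candidates_separated (commonDen_pos B (k + 1)) hs.q_lt hs'.q_lt hlt.ne'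
  have hpos : 0 ≤ centre B u (k + 1) (i + 1) - centre B u (k + 1) i := by
    unfold centre
    rw [← sub_div]
    apply div_nonneg _ hD.le
    have : (node B u (k + 1) i : ℝ) ≤ node B u (k + 1) (i + 1) := by exact_mod_cast hlt.le
    linarith
  rw [abs_of_nonneg hpos] at hsep
  have hr := (radius_bounds h hi).2
  have hr' := (radius_bounds h hi').2
  have hE := two_mul_scale_add_le_expo h (show 1 ≤ k + 1 by omega)
  have h3 : (1 : ℝ) / 2 ^ expo B u (k + 1) ≤ 1 / (16 * (2 ^ scale B (k + 1)) ^ 2) := by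
    apply one_div_le_one_div_of_le (by positivity)
    calc (16 : ℝ) * (2 ^ scale B (k + 1)) ^ 2 = 2 ^ (2 * scale B (k + 1) + 4) := by
          rw [pow_add, mul_comm 2, pow_mul]; norm_num; ring
      _ ≤ _ := pow_le_pow_right₀ (by norm_num) hE
  push_cast at hsep
  have e1 : 1 / (16 * ((2 : ℝ) ^ scale B (k + 1)) ^ 2) =
      1 / ((2 : ℝ) ^ scale B (k + 1)) ^ 2 / 16 := by field_simp
  have e2 : 1 / (8 * ((2 : ℝ) ^ scale B (k + 1)) ^ 2) =
      1 / ((2 : ℝ) ^ scale B (k + 1)) ^ 2 / 8 := by field_simp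
  have e3 : 1 / (4 * ((2 : ℝ) ^ scale B (k + 1)) ^ 2) =
      1 / ((2 : ℝ) ^ scale B (k + 1)) ^ 2 / 4 := by field_simp
  rw [e1] at h3
  rw [e3] at hsep
  rw [e2, left_succ, right_succ]
  linarith

theorem gap (h : Admissible B u) : ∀ k i, i + 1 < (data B u).count k →
    (data B u).right k i + 1 / (8 * ((2 : ℝ) ^ scale B k) ^ 2)
      ≤ (data B u).left k (i + 1) := by
  intro k
  induction k with
  | zero => intro i hi; rw [count_zero] at hi; omega
  | succ k ih =>
    intro i hi
    have hm := two_le_branch_succ h k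
    rcases eq_or_ne ((i + 1) / branch B u (k + 1)) (i / branch B u (k + 1)) with hpar | hpar
    · exact gap_of_siblings h hi hpar
    -- Neighbours with different parents lie in neighbouring parents and inherit their gap, which is
    -- larger.
    · have hpar' : (i + 1) / branch B u (k + 1) = i / branch B u (k + 1) + 1 := by
        have h1 : i / branch B u (k + 1) ≤ (i + 1) / branch B u (k + 1) :=
          Nat.div_le_div_right (by omega)
        have h2 : (i + 1) / branch B u (k + 1) ≤ (i + branch B u (k + 1)) / branch B u (k + 1) :=
          Nat.div_le_div_right (by omega)
        rw [Nat.add_div_right _ (by omega)] at h2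
        omega
      have hi' : i < (data B u).count (k + 1) := by omega
      have hlt := div_branch_lt_count hi
      have h1 := (child_bounds h hi').2
      have h2 := (child_bounds h hi).1
      rw [hpar'] at h2 hlt
      have h3 := ih _ hlt
      have h4 := (centre_bounds h hlt).1
      have h0 : (0 : ℝ) < 1 / 2 ^ (expo B u k + B) / 4 := by positivity
      have h5 : 1 / (8 * ((2 : ℝ) ^ scale B (k + 1)) ^ 2) ≤ 1 / (8 * ((2 : ℝ) ^ scale B k) ^ 2) := by
        have := (scale_lt_scale_succ h k).le
        gcongr
        norm_num
      linarith

/-- The constant is `2 ^ (-(B + 7))` from `branch`, halved for the rounding in the integer division;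
`log 2` converts the logarithm to base two. -/
theorem branch_ge (h : Admissible B u) (k : ℕ) :
    Real.log 2 / 2 ^ (B + 8) * ((2 : ℝ) ^ scale B (k + 1)) ^ 2 /
      (2 ^ expo B u k * Real.log (2 ^ scale B (k + 1))) ≤ branch B u (k + 1) := by
  obtain ⟨e, he, hb, he2⟩ := exists_branch_eq h k
  have hx : ((2 : ℝ) ^ e) / (k + 1) ≤ 2 * branch B u (k + 1) := by
    have h1 : 2 ^ e < (branch B u (k + 1) + 1) * (k + 1) := by
      rw [hb]; exact Nat.lt_mul_of_div_lt (Nat.lt_succ_self _) (by omega)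
    have h2 := two_le_branch_succ h k
    rw [div_le_iff₀ (by positivity)]
    have h3 : 2 ^ e ≤ 2 * branch B u (k + 1) * (k + 1) :=
      h1.le.trans (Nat.mul_le_mul_right _ (by omega))
    exact_mod_cast h3
  have hl : 0 < Real.log 2 := Real.log_pos (by norm_num)
  have e4 : ((2 : ℝ) ^ scale B (k + 1)) ^ 2 = 2 ^ e * 2 ^ expo B u k * 2 ^ (rate B * (k + 1)) *
      (2 ^ B * 2 ^ 7) := by
    rw [← pow_mul, mul_comm, he, pow_add, pow_add, pow_add, pow_add 2 B 7]
  have hk : (0 : ℝ) < k + 1 := by positivity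
  have e5 : Real.log 2 / 2 ^ (B + 8) * ((2 : ℝ) ^ scale B (k + 1)) ^ 2 /
      (2 ^ expo B u k * Real.log (2 ^ scale B (k + 1))) = ((2 : ℝ) ^ e) / (k + 1) / 2 := by
    rw [Real.log_pow, scale_succ_cast, e4, pow_add 2 B 8]
    field_simp
  rw [e5]
  linarith

theorem isCantorLike (h : Admissible B u) : (data B u).IsCantorLike where
  two_le_m k hk := by
    obtain ⟨k, rfl⟩ := Nat.exists_eq_add_of_le' hk
    exact two_le_branch_succ h k
  M_lt k _ := Nat.pow_lt_pow_right (by norm_num) (scale_lt_scale_succ h k)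
  two_lt_b k hk := by
    obtain ⟨k, rfl⟩ := Nat.exists_eq_add_of_le' hk
    have h1 := h.lt (k + 1) hk
    simp only [data, Nat.add_sub_cancel]
    rw [lt_div_iff₀ (by positivity)]
    exact_mod_cast h1
  prime_q k hk i hi := by
    obtain ⟨k, rfl⟩ := Nat.exists_eq_add_of_le' hk
    exact (childSpec h hi).prime
  lt_q k hk i hi := by
    obtain ⟨k, rfl⟩ := Nat.exists_eq_add_of_le' hk
    exact (childSpec h hi).lt_q
  q_lt k hk i hi := by
    obtain ⟨k, rfl⟩ := Nat.exists_eq_add_of_le' hk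
    exact (childSpec h hi).q_lt
  nested k i hi c hc := by
    change c < branch B u (k + 1) at hc
    change (data B u).interval (k + 1) (i * branch B u (k + 1) + c) ⊆ _
    have h1 : (i * branch B u (k + 1) + c) / branch B u (k + 1) = i := by
      rw [mul_comm, Nat.mul_add_div (by omega), Nat.div_eq_of_lt hc, add_zero]
    have h2 : i * branch B u (k + 1) + c < (data B u).count (k + 1) := by
      rw [count_succ]
      calc i * branch B u (k + 1) + c < (i + 1) * branch B u (k + 1) := by
            rw [add_mul, one_mul]; omega
        _ ≤ _ := Nat.mul_le_mul_right _ hi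
    have h3 := interval_subset h h2
    rwa [h1] at h3
  gap k _ i hi := by
    have := gap h k i hi
    simpa [data] using this
  branching := by
    refine ⟨Real.log 2 / 2 ^ (B + 8), div_pos (Real.log_pos (by norm_num)) (by positivity), ?_⟩
    intro k hk
    have h1 := branch_ge h k
    obtain ⟨k, rfl⟩ := Nat.exists_eq_add_of_le' hk
    have h2 : (((data B u).M (k + 1) : ℕ) : ℝ) ^ ((data B u).b (k + 1) : ℝ)
        = 2 ^ expo B u (k + 1) := by
      rw [data_b_succ, ← two_pow_scale_rpow]
      simp [data]
    rw [h2]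
    simpa [data] using h1

end JarnikConstruction

/-! ### The irrationality exponent of the points of the limit set. -/

namespace JarnikConstruction

variable {B : ℕ} {u : ℕ → ℕ}

theorem mul_self_le_scale (B k : ℕ) : k * k ≤ scale B k := by
  unfold scale rate
  refine Nat.mul_le_mul_left _ (Nat.lt_two_pow_self.le.trans (Nat.pow_le_pow_right (by norm_num) ?_))
  nlinarith [Nat.zero_le (B * k)]

/-- Fractions whose denominators lie between the thresholds belonging to two consecutive levels
are not very close to the points of the limit set. -/
theorem abs_sub_div_ge (h : Admissible B u) {k i : ℕ} (hi : i < (data B u).count (k + 2)) {x : ℝ}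
    (hx : x ∈ (data B u).interval (k + 2) i) {t : ℕ} (ht₀ : 2 ^ (expo B u k - scale B k - 2) ≤ t)
    (ht₁ : t < 2 ^ (expo B u (k + 1) - scale B (k + 1) - 2)) (p : ℤ) :
    1 / (2 ^ (slack B * (k + 1) + 2) * (t : ℝ) ^ 2) ≤ |x - p / t| ∨
      2 ^ scale B (k + 1) ≤ t ∧ 1 / 2 ^ (expo B u (k + 1) + B + 2) ≤ |x - p / t| := by
  have hj := div_branch_lt_count hi
  have hin := interval_subset h hi hx
  have hcb := (child_bounds h hi).1
  set j := i / branch B u (k + 1 + 1)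
  rw [left_succ, right_succ] at hin
  have hs := childSpec h hj
  have hr := (radius_bounds h hj).2
  have hE := expo_add_le_scale_succ h k
  have hF := two_mul_scale_le_expo h (k + 1)
  set y := centre B u (k + 1) j with hy
  set N := scale B (k + 1)
  set F := expo B u (k + 1)
  set s := slack B * (k + 1)
  have hxy : |x - y| ≤ 1 / 2 ^ F := by
    rw [abs_le]; constructor <;> linarith [hin.1, hin.2]
  have ht : 0 < t := lt_of_lt_of_le (by positivity) ht₀
  have htR : (0 : ℝ) < t := by exact_mod_cast ht
  have htri : |y - p / t| ≤ |x - p / t| + |x - y| := by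
    have := abs_sub_le y x ((p : ℝ) / t)
    rw [abs_sub_comm y x] at this
    linarith
  -- For small `t` the centre `y` keeps `2 / (2 ^ s t²)` away by choice, and passing from `y` to `x`
  -- costs at most half of that.
  rcases lt_or_ge t (2 ^ (N - s)) with hts | hts
  · left
    have hav := hs.avoids t ht₀ hts p
    have htN : (t : ℝ) ≤ 2 ^ (N - s) := by exact_mod_cast hts.le
    have h1 : 1 / (2 : ℝ) ^ F ≤ 1 / (2 ^ s * (t : ℝ) ^ 2) := by
      apply one_div_le_one_div_of_le (by positivity)
      calc (2 : ℝ) ^ s * (t : ℝ) ^ 2 ≤ 2 ^ s * (2 ^ (N - s)) ^ 2 := by gcongr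
        _ = 2 ^ (s + (N - s) * 2) := by rw [← pow_mul, ← pow_add]
        _ ≤ 2 ^ F := pow_le_pow_right₀ (by norm_num) (by omega)
    have h2 : 2 / (2 ^ s * (t : ℝ) ^ 2) = 1 / (2 ^ s * (t : ℝ) ^ 2) + 1 / (2 ^ s * (t : ℝ) ^ 2) := by
      ring
    have h3 : 1 / (2 ^ (s + 2) * (t : ℝ) ^ 2) ≤ 1 / (2 ^ s * (t : ℝ) ^ 2) := by
      apply one_div_le_one_div_of_le (by positivity)
      gcongr
      · norm_num
      · omega
    rw [← hy, h2] at hav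
    linarith
  · have hq : 0 < (data B u).q (k + 1) j := hs.prime.pos
    have hqR : (0 : ℝ) < (data B u).q (k + 1) j := by exact_mod_cast hq
    have hyq := p_div_q (B := B) (u := u) (k + 1) j
    rw [← hy] at hyq
    -- If `p / t` is the centre itself, then `q` divides `t`, and `x` lies to the right of `y` by at
    -- least a quarter of the guaranteed radius.
    by_cases hpy : y = p / t
    · right
      constructor
      · refine hs.lt_q.le.trans (Nat.le_of_dvd ht ?_)
        have hco : ((data B u).p (k + 1) j).Coprime ((data B u).q (k + 1) j) :=
          Nat.coprime_div_gcd_div_gcd (Nat.gcd_pos_of_pos_right _ (commonDen_pos B (k + 1)))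
        rw [← hyq, div_eq_div_iff hqR.ne' htR.ne'] at hpy
        have hz : ((data B u).p (k + 1) j : ℤ) * t = p * ((data B u).q (k + 1) j : ℤ) := by
          exact_mod_cast hpy
        have hdvd : ((data B u).q (k + 1) j : ℤ) ∣ ((data B u).p (k + 1) j : ℤ) * t :=
          ⟨p, by rw [hz, mul_comm]⟩
        have hdvd' : (data B u).q (k + 1) j ∣ (data B u).p (k + 1) j * t := by
          exact_mod_cast hdvd
        exact hco.symm.dvd_of_dvd_mul_left hdvd'
      · rw [← hpy]
        refine le_trans ?_ (le_abs_self _)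
        have e2 : (1 : ℝ) / 2 ^ (F + B + 2) = 1 / 2 ^ (F + B) / 4 := by
          rw [pow_add]; field_simp; norm_num
        rw [e2]
        linarith [hx.1]
    · left
      -- Otherwise `1 / (q t)` separates `p / t` from `y`. The radius is at most half of this
      -- because `t < 2 ^ (F - N - 2)`, and `q ≤ 2 ^ (s + 1) t` turns it into a multiple of `1 /
      -- t²`.
      have hgap := one_div_mul_le_abs_div_sub_div (p := ((data B u).p (k + 1) j : ℤ)) (p' := p)
        hq ht
      rw [Int.cast_natCast, hyq] at hgap
      have hgap' := hgap hpy
      have hq2 : ((data B u).q (k + 1) j : ℝ) ≤ 2 * 2 ^ N := by exact_mod_cast hs.q_lt.le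
      have ht2 : (t : ℝ) ≤ 2 ^ (F - N - 2) := by exact_mod_cast ht₁.le
      have hNF : N + 2 ≤ F := by
        by_contra hc
        rw [show F - N - 2 = 0 by omega, pow_zero] at ht₁
        omega
      have h1 : 1 / (2 : ℝ) ^ F ≤ 1 / (2 * ((data B u).q (k + 1) j * (t : ℝ))) := by
        apply one_div_le_one_div_of_le (by positivity)
        calc 2 * (((data B u).q (k + 1) j : ℝ) * (t : ℝ)) ≤ 2 * (2 * 2 ^ N * 2 ^ (F - N - 2)) := by
              gcongr
          _ = 2 ^ (N + (F - N - 2) + 2) := by rw [pow_add _ (_ + _), pow_add]; ring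
          _ ≤ 2 ^ F := pow_le_pow_right₀ (by norm_num) (by omega)
      have h2 : 1 / (((data B u).q (k + 1) j : ℝ) * (t : ℝ)) =
          1 / (2 * ((data B u).q (k + 1) j * (t : ℝ))) +
          1 / (2 * ((data B u).q (k + 1) j * (t : ℝ))) := by
        field_simp; norm_num
      have h3 : 1 / (2 ^ (s + 2) * (t : ℝ) ^ 2) ≤ 1 / (2 * ((data B u).q (k + 1) j * (t : ℝ))) := by
        apply one_div_le_one_div_of_le (by positivity)
        have hts' : (2 : ℝ) ^ (N - s) ≤ t := by exact_mod_cast hts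
        have h4 : (2 : ℝ) ^ N ≤ 2 ^ s * t := by
          calc (2 : ℝ) ^ N = 2 ^ s * 2 ^ (N - s) := by rw [← pow_add]; congr 1; omega
            _ ≤ _ := by gcongr
        calc 2 * (((data B u).q (k + 1) j : ℝ) * t) ≤ 2 * (2 * (2 ^ s * t) * t) := by
              gcongr; linarith
          _ = _ := by rw [pow_add]; ring
      linarith

/-- The threshold between the denominators that are dealt with at level `k` and at level `k + 1`. -/
theorem exists_level (h : Admissible B u) (K : ℕ) : ∃ Q : ℕ, ∀ t, Q ≤ t → ∃ k, K ≤ k ∧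
    2 ^ (expo B u k - scale B k - 2) ≤ t ∧ t < 2 ^ (expo B u (k + 1) - scale B (k + 1) - 2) := by
  classical
  let T : ℕ → ℕ := fun k => 2 ^ (expo B u k - scale B k - 2)
  -- The sum bounds every threshold up to level `K` without using monotonicity.
  refine ⟨∑ j ∈ Finset.range (K + 1), T j, fun t ht => ?_⟩
  have hT : ∀ j, j ≤ K → T j ≤ t := fun j hj =>
    (Finset.single_le_sum (f := T) (fun _ _ => Nat.zero_le _)
      (Finset.mem_range.2 (Nat.lt_succ_of_le hj))).trans ht
  have hex : ∃ k, t < T (k + 1) := by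
    refine ⟨t + 2, ?_⟩
    have h1 := two_mul_scale_le_expo h (t + 3)
    have h2 := mul_self_le_scale B (t + 3)
    have h3 : t + 2 ≤ (t + 3) * (t + 3) - 2 := by
      have : t + 4 ≤ (t + 3) * (t + 3) := by nlinarith
      omega
    change t < 2 ^ (expo B u (t + 3) - scale B (t + 3) - 2)
    calc t < 2 ^ t := Nat.lt_two_pow_self
      _ ≤ _ := Nat.pow_le_pow_right (by norm_num) (by omega)
  have hfind := Nat.find_spec hex
  have hK : K ≤ Nat.find hex := by
    by_contra hc
    push Not at hc
    have := hT (Nat.find hex + 1) hc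
    omega
  refine ⟨Nat.find hex, hK, ?_, hfind⟩
  rcases Nat.eq_zero_or_pos (Nat.find hex) with h0 | h0
  · rw [h0]; exact hT 0 (Nat.zero_le _)
  · have := Nat.find_min hex (m := Nat.find hex - 1) (by omega)
    rw [Nat.sub_add_cancel h0] at this
    exact not_lt.1 this

theorem exists_mem_interval {x : ℝ} (hx : x ∈ (data B u).limitSet) (k : ℕ) :
    ∃ i, i < (data B u).count k ∧ x ∈ (data B u).interval k i := by
  have := Set.mem_iInter.1 hx k
  simpa only [Set.mem_iUnion, exists_prop] using this

/-- In the first alternative of `abs_sub_div_ge` the loss is `2` to a power linear in `k`, while `t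
≥ 2 ^ (k² - 2)`, so `t ^ (z - 2)` absorbs it. In the second, `expo` is at most `(a + ε) * scale` and
the constant `B + 2` fits into another `ε * scale`, where `z = a + 2 ε`. -/
theorem eventually_one_div_rpow_le (h : Admissible B u) {a z : ℝ} (ha : 2 ≤ a) (haz : a < z)
    (hub : ∀ ε : ℝ, 0 < ε → ∃ K : ℕ, ∀ k ≥ K, (u k : ℝ) ≤ (a + ε) * k) {x : ℝ}
    (hx : x ∈ (data B u).limitSet) :
    ∃ Q : ℕ, ∀ t : ℕ, Q ≤ t → ∀ p : ℤ, 1 / (t : ℝ) ^ z ≤ |x - p / t| := by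
  set ε := (z - a) / 2 with hε
  have hε0 : 0 < ε := by rw [hε]; linarith
  obtain ⟨K₁, hK₁⟩ := hub ε hε0
  obtain ⟨K₂, hK₂⟩ := exists_nat_ge ((2 * slack B + 2 + B + 4 * ε) / (2 * ε))
  obtain ⟨K₃, hK₃⟩ := exists_nat_ge (((B : ℝ) + 2) / ε)
  obtain ⟨Q, hQ⟩ := exists_level h (K₁ + K₂ + K₃ + 1)
  refine ⟨Q, fun t ht p => ?_⟩
  obtain ⟨k, hk, ht₀, ht₁⟩ := hQ t ht
  obtain ⟨i, hi, hxi⟩ := exists_mem_interval hx (k + 2)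
  have htpos : 0 < t := lt_of_lt_of_le (by positivity) ht₀
  have htR : (0 : ℝ) < t := by exact_mod_cast htpos
  have hz : 0 < z := by linarith
  rcases abs_sub_div_ge h hi hxi ht₀ ht₁ p with h1 | ⟨h1, h2⟩
  · refine le_trans ?_ h1
    apply one_div_le_one_div_of_le (by positivity)
    have e : (t : ℝ) ^ z = (t : ℝ) ^ (z - 2) * (t : ℝ) ^ 2 := by
      rw [← Real.rpow_natCast (t : ℝ) 2, ← Real.rpow_add htR]; congr 1; push_cast; ring
    rw [e]
    refine mul_le_mul_of_nonneg_right ?_ (by positivity)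
    have hj : k * k - 2 ≤ expo B u k - scale B k - 2 := by
      have := two_mul_scale_le_expo h k
      have := mul_self_le_scale B k
      omega
    have ht2 : (2 : ℝ) ^ ((k * k - 2 : ℕ) : ℝ) ≤ t := by
      rw [Real.rpow_natCast]
      exact_mod_cast (Nat.pow_le_pow_right (by norm_num) hj).trans ht₀
    have hkk : ((k : ℝ) * k - 2) ≤ ((k * k - 2 : ℕ) : ℝ) := by
      have : k * k ≤ (k * k - 2) + 2 := by omega
      have : ((k * k : ℕ) : ℝ) ≤ (((k * k - 2) + 2 : ℕ) : ℝ) := by exact_mod_cast this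
      push_cast at this ⊢
      linarith
    calc (2 : ℝ) ^ (slack B * (k + 1) + 2)
        = (2 : ℝ) ^ ((slack B * (k + 1) + 2 : ℕ) : ℝ) := by rw [Real.rpow_natCast]
      _ ≤ (2 : ℝ) ^ (((k * k - 2 : ℕ) : ℝ) * (z - 2)) := by
          apply Real.rpow_le_rpow_of_exponent_le (by norm_num)
          rw [div_le_iff₀ (by positivity)] at hK₂
          have hkR : (K₂ : ℝ) ≤ k := by exact_mod_cast (by omega : K₂ ≤ k)
          have hk1 : (1 : ℝ) ≤ k := by exact_mod_cast (by omega : 1 ≤ k)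
          have hz2 : 2 * ε ≤ z - 2 := by rw [hε]; linarith
          have h3 : (2 * slack B + 2 + B + 4 * ε) ≤ k * (2 * ε) := hK₂.trans (by gcongr)
          have h4 : (2 * slack B + 2 + B + 4 * ε) * k ≤ k * (2 * ε) * k := by gcongr
          have hB0 : (0 : ℝ) ≤ B := by positivity
          have hS0 : (0 : ℝ) ≤ slack B := by positivity
          have h5 : (slack B : ℝ) * (k + 1) + 2 ≤ ((k : ℝ) * k - 2) * (2 * ε) := by nlinarith
          push_cast
          have h6 : 0 ≤ ((k * k - 2 : ℕ) : ℝ) := by positivity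
          calc (slack B : ℝ) * (k + 1) + 2 ≤ ((k : ℝ) * k - 2) * (2 * ε) := h5
            _ ≤ ((k * k - 2 : ℕ) : ℝ) * (2 * ε) := by gcongr
            _ ≤ _ := by gcongr
      _ = ((2 : ℝ) ^ ((k * k - 2 : ℕ) : ℝ)) ^ (z - 2) := by rw [Real.rpow_mul (by norm_num)]
      _ ≤ (t : ℝ) ^ (z - 2) := Real.rpow_le_rpow (by positivity) ht2 (by linarith)
  · refine le_trans ?_ h2
    apply one_div_le_one_div_of_le (by positivity)
    have hN : ((k : ℝ) + 1) ≤ scale B (k + 1) := by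
      have : k + 1 ≤ scale B (k + 1) := le_trans (by nlinarith) (mul_self_le_scale B (k + 1))
      exact_mod_cast this
    have hF : (expo B u (k + 1) : ℝ) ≤ (a + ε) * scale B (k + 1) := by
      have h3 := hK₁ (k + 1) (by omega)
      rw [scale_succ_cast, expo]
      push_cast at h3 ⊢
      calc (u (k + 1) : ℝ) * 2 ^ (rate B * (k + 1))
          ≤ ((a + ε) * (k + 1)) * 2 ^ (rate B * (k + 1)) := by gcongr
        _ = _ := by ring
    have ht2 : (2 : ℝ) ^ (scale B (k + 1) : ℝ) ≤ t := by
      rw [Real.rpow_natCast]; exact_mod_cast h1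
    calc (2 : ℝ) ^ (expo B u (k + 1) + B + 2)
        = (2 : ℝ) ^ ((expo B u (k + 1) + B + 2 : ℕ) : ℝ) := by rw [Real.rpow_natCast]
      _ ≤ (2 : ℝ) ^ ((scale B (k + 1) : ℝ) * z) := by
          apply Real.rpow_le_rpow_of_exponent_le (by norm_num)
          rw [div_le_iff₀ hε0] at hK₃
          have hkR : (K₃ : ℝ) ≤ k := by exact_mod_cast (by omega : K₃ ≤ k)
          have hzε : z = a + ε + ε := by rw [hε]; ring
          rw [hzε]
          push_cast
          have h5 : (K₃ : ℝ) * ε ≤ scale B (k + 1) * ε  :=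
            mul_le_mul_of_nonneg_right (by linarith) hε0.le
          nlinarith
      _ = ((2 : ℝ) ^ (scale B (k + 1) : ℝ)) ^ z := by rw [Real.rpow_mul (by norm_num)]
      _ ≤ (t : ℝ) ^ z := Real.rpow_le_rpow (by positivity) ht2 hz.le

/-- The centres at the levels with `b k ≥ a` are the good approximations. They differ from `x`
because later intervals lie strictly to their right, and their denominators are unbounded. -/
theorem infinite_of_lt (h : Admissible B u) {a z : ℝ} (haz : z < a)
    (hlb : ∀ K : ℕ, ∃ k ≥ K, a * k ≤ u k) {x : ℝ} (hx : x ∈ (data B u).limitSet) :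
    {pq : ℤ × ℤ | 0 < pq.2 ∧ 0 < |x - (pq.1 : ℝ) / (pq.2 : ℝ)| ∧
      |x - (pq.1 : ℝ) / (pq.2 : ℝ)| < 1 / (pq.2 : ℝ) ^ z}.Infinite := by
  intro hfin
  obtain ⟨Q, hQ⟩ := (hfin.image Prod.snd).bddAbove
  obtain ⟨k, hk, hak⟩ := hlb (Q.toNat + 1)
  obtain ⟨k, rfl⟩ := Nat.exists_eq_add_of_le' (show 1 ≤ k by omega)
  obtain ⟨i, hi, hxi⟩ := exists_mem_interval hx (k + 2)
  have hj := div_branch_lt_count hi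
  have hin := interval_subset h hi hxi
  have hcb := (child_bounds h hi).1
  set j := i / branch B u (k + 1 + 1)
  rw [left_succ, right_succ] at hin
  have hs := childSpec h hj
  have hlt : ((data B u).q (k + 1) j : ℤ) ≤ Q := by
    refine hQ ⟨(((data B u).p (k + 1) j : ℤ), ((data B u).q (k + 1) j : ℤ)), ?_, rfl⟩
    have hq1 : (1 : ℝ) < (data B u).q (k + 1) j := by exact_mod_cast hs.prime.one_lt
    simp only [Set.mem_ofPred_eq, Int.cast_natCast, p_div_q]
    refine ⟨by exact_mod_cast hs.prime.pos, ?_, ?_⟩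
    · rw [abs_pos]
      have h0 : (0 : ℝ) < 1 / 2 ^ (expo B u (k + 1) + B) / 4 := by positivity
      have := hxi.1
      intro hc
      linarith
    · have h1 : |x - centre B u (k + 1) j| < radius B u k j := by
        rw [abs_lt]; constructor <;> linarith [hin.1, hin.2]
      refine h1.trans_le ?_
      rw [radius, data_b_succ, Real.rpow_neg (by positivity), ← one_div]
      apply one_div_le_one_div_of_le (by positivity)
      apply Real.rpow_le_rpow_of_exponent_le hq1.le
      refine haz.le.trans ?_
      rw [le_div_iff₀ (by positivity)]
      exact_mod_cast hak
  have h1 := hs.lt_q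
  have h2 : k + 1 ≤ scale B (k + 1) := le_trans (by nlinarith) (mul_self_le_scale B (k + 1))
  have h3 := (Nat.lt_two_pow_self (n := scale B (k + 1)))
  omega

/-- All the points of the limit set have irrationality exponent `a = limsup (u k / k)`. -/
theorem hasIrrationalityExponent (h : Admissible B u) {a : ℝ} (ha : 2 ≤ a)
    (hub : ∀ ε : ℝ, 0 < ε → ∃ K : ℕ, ∀ k ≥ K, (u k : ℝ) ≤ (a + ε) * k)
    (hlb : ∀ K : ℕ, ∃ k ≥ K, a * k ≤ u k) {x : ℝ} (hx : x ∈ (data B u).limitSet) :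
    HasIrrationalityExponent x a := by
  constructor
  · intro z hz
    by_contra! haz
    apply hz
    obtain ⟨Q, hQ⟩ := eventually_one_div_rpow_le h ha haz hub hx
    -- A bounded denominator leaves finitely many numerators, since the fraction is within `1` of
    -- `x`.
    obtain ⟨P, hP⟩ := exists_nat_ge ((|x| + 1) * Q)
    refine ((Set.finite_Icc (-(P : ℤ)) P).prod (Set.finite_Icc (0 : ℤ) Q)).subset ?_
    rintro ⟨p, q⟩ ⟨hq, -, hlt⟩
    simp only at hq hlt
    lift q to ℕ using hq.le
    rw [Int.cast_natCast] at hlt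
    have hqpos : 0 < q := by exact_mod_cast hq
    have hqQ : q < Q := by
      by_contra! hc
      exact absurd (hQ q hc p) (not_le.2 hlt)
    have hq1 : (1 : ℝ) ≤ q := by exact_mod_cast hqpos
    have h1 : |x - p / q| < 1 := by
      refine hlt.trans_le ?_
      rw [div_le_one (by positivity)]
      exact Real.one_le_rpow hq1 (by linarith)
    have h2 : |(p : ℝ) / q| ≤ |x| + 1 := by
      have := abs_sub_abs_le_abs_sub ((p : ℝ) / q) x
      rw [abs_sub_comm] at this
      linarith
    have h3 : |(p : ℝ)| ≤ P := by
      rw [abs_div, Nat.abs_cast, div_le_iff₀ (by linarith)] at h2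
      refine h2.trans (le_trans ?_ hP)
      have : (q : ℝ) ≤ Q := by exact_mod_cast hqQ.le
      gcongr
    rw [abs_le] at h3
    refine Set.mem_prod.2 ⟨⟨?_, ?_⟩, ⟨?_, ?_⟩⟩
    · exact_mod_cast h3.1
    · exact_mod_cast h3.2
    · simp
    · simpa using hqQ.le
  · intro b hb
    by_contra! hba
    obtain ⟨z, hz1, hz2⟩ := exists_between hba
    exact absurd (hb (infinite_of_lt h hz2 hlb hx)) (not_le.2 hz1)

end JarnikConstruction

theorem Primrec.nat_pow : Primrec₂ ((· ^ ·) : ℕ → ℕ → ℕ) :=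
  Primrec₂.unpaired'.1 Nat.Primrec.pow

theorem Primrec.int_natCast : Primrec (fun n : ℕ => (n : ℤ)) := by
  rw [← Primrec.encode_iff]
  refine (Primrec.nat_mul.comp (Primrec.const 2) Primrec.id).of_eq fun n => ?_
  rfl

/-! ### Addresses, natural measure and computable points of a general construction. -/

namespace JarnikData

variable {D : JarnikData}

theorem count_succ (k : ℕ) : D.count (k + 1) = D.count k * D.m (k + 1) := by
  rw [count, Finset.prod_range_succ]; rfl

theorem count_zero : D.count 0 = 1 := by simp [count]

theorem computable_count (hD : Computable D.m) : Computable D.count := by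
  have h : Computable (fun k : ℕ => Nat.rec (motive := fun _ => ℕ) 1
      (fun k v => v * D.m (k + 1)) k) :=
    Computable.nat_rec (f := fun k : ℕ => k) (g := fun _ => 1)
      (h := fun (_ : ℕ) (x : ℕ × ℕ) => x.2 * D.m (x.1 + 1)) Computable.id (Computable.const 1)
      (Primrec.nat_mul.to_comp.comp (Computable.snd.comp Computable.snd)
        (hD.comp (Computable.succ.comp (Computable.fst.comp Computable.snd))))
  refine h.of_eq fun k => ?_
  induction k with
  | zero => simp [JarnikData.count]
  | succ k ih => rw [count_succ, ← ih]

namespace IsCantorLike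

variable (h : D.IsCantorLike)

include h

theorem two_pow_le_count (k : ℕ) : 2 ^ k ≤ D.count k := by
  induction k with
  | zero => simp [count_zero]
  | succ k ih =>
    rw [count_succ, pow_succ]
    exact Nat.mul_le_mul ih (h.two_le_m (k + 1) (by omega))

theorem count_pos (k : ℕ) : 0 < D.count k := lt_of_lt_of_le (by positivity) (h.two_pow_le_count k)

theorem count_lt_count_succ (k : ℕ) : D.count k < D.count (k + 1) := by
  have h1 := h.two_le_m (k + 1) (by omega)
  have h2 := h.count_pos k
  rw [count_succ]
  nlinarith

theorem le_M (k : ℕ) : k ≤ D.M (k + 1) := by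
  induction k with
  | zero => omega
  | succ k ih => have := h.M_lt (k + 1) (by omega); omega

theorem left_le_right {k i : ℕ} (hi : i < D.count k) : D.left k i ≤ D.right k i := by
  cases k with
  | zero => simp [left, right]
  | succ k =>
    have hq : (0 : ℝ) < D.q (k + 1) i := by exact_mod_cast (h.prime_q (k + 1) (by omega) i hi).pos
    have := Real.rpow_pos_of_pos hq (-(D.b (k + 1) : ℝ))
    simp only [left, right]
    linarith

theorem right_lt_left {k i j : ℕ} (hij : i < j) (hj : j < D.count k) :
    D.right k i < D.left k j := by
  have hk : 1 ≤ k := by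
    by_contra hk
    obtain rfl : k = 0 := by omega
    rw [count_zero] at hj
    omega
  have hgap : ∀ i, i + 1 < D.count k → D.right k i < D.left k (i + 1) := by
    intro i hi
    have hM : (0 : ℝ) < D.M k := by
      have h1 := h.lt_q k hk i (by omega)
      have h2 := h.q_lt k hk i (by omega)
      exact_mod_cast (by omega : 0 < D.M k)
    have h3 := h.gap k hk i hi
    have : (0 : ℝ) < 1 / (8 * (D.M k : ℝ) ^ 2) := by positivity
    linarith
  induction j, hij using Nat.le_induction with
  | base => exact hgap i hj
  | succ j hij ih =>
    have h1 := ih (by omega)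
    have h2 := h.left_le_right (k := k) (i := j) (by omega)
    have h3 := hgap j hj
    linarith

theorem eq_of_mem_interval {k i j : ℕ} (hi : i < D.count k) (hj : j < D.count k) {x : ℝ}
    (hxi : x ∈ D.interval k i) (hxj : x ∈ D.interval k j) : i = j := by
  by_contra hne
  rcases Nat.lt_or_gt_of_ne hne with hlt | hlt
  · have := h.right_lt_left hlt hj
    linarith [hxi.2, hxj.1]
  · have := h.right_lt_left hlt hi
    linarith [hxj.2, hxi.1]

omit h in
/-- The number of the interval of level `k` that corresponds to the address `t ∈ [0, 1)`. -/
noncomputable def address (D : JarnikData) (t : ℝ) (k : ℕ) : ℕ := ⌊t * D.count k⌋₊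

omit h in
/-- The point of the limit set with the address `t ∈ [0, 1)`. -/
noncomputable def point (D : JarnikData) (t : ℝ) : ℝ := ⨆ k, D.left k (address D t k)

theorem address_lt {t : ℝ} (ht : t ∈ Set.Ico (0 : ℝ) 1) (k : ℕ) : address D t k < D.count k := by
  have hc : (0 : ℝ) < D.count k := by exact_mod_cast h.count_pos k
  rw [address, Nat.floor_lt (mul_nonneg ht.1 hc.le)]
  nlinarith [ht.2]

theorem address_succ (t : ℝ) (k : ℕ) :
    address D t (k + 1) / D.m (k + 1) = address D t k := by
  have hm : (0 : ℝ) < D.m (k + 1) := by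
    exact_mod_cast (by have := h.two_le_m (k + 1) (by omega); omega : 0 < D.m (k + 1))
  rw [address, ← Nat.floor_div_natCast, count_succ, address]
  congr 1
  push_cast
  field_simp

theorem interval_address_subset {t : ℝ} (ht : t ∈ Set.Ico (0 : ℝ) 1) (k : ℕ) :
    D.interval (k + 1) (address D t (k + 1)) ⊆
      Set.Ioo (D.left k (address D t k)) (D.right k (address D t k)) := by
  have hm := h.two_le_m (k + 1) (by omega)
  have h1 := h.nested k (address D t k) (h.address_lt ht k)
    (address D t (k + 1) % D.m (k + 1)) (Nat.mod_lt _ (by omega))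
  rwa [← h.address_succ t k, mul_comm, Nat.div_add_mod, h.address_succ t k] at h1

theorem left_address_mono {t : ℝ} (ht : t ∈ Set.Ico (0 : ℝ) 1) :
    Monotone fun k => D.left k (address D t k) := by
  refine monotone_nat_of_le_succ fun k => ?_
  have := h.left_le_right (h.address_lt ht (k + 1))
  exact (h.interval_address_subset ht k ⟨le_refl _, this⟩).1.le

theorem right_address_anti {t : ℝ} (ht : t ∈ Set.Ico (0 : ℝ) 1) :
    Antitone fun k => D.right k (address D t k) := by
  refine antitone_nat_of_succ_le fun k => ?_
  have := h.left_le_right (h.address_lt ht (k + 1))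
  exact (h.interval_address_subset ht k ⟨this, le_refl _⟩).2.le

theorem left_le_right_address {t : ℝ} (ht : t ∈ Set.Ico (0 : ℝ) 1) (j k : ℕ) :
    D.left j (address D t j) ≤ D.right k (address D t k) :=
  (h.left_address_mono ht (le_max_left j k)).trans
    ((h.left_le_right (h.address_lt ht _)).trans (h.right_address_anti ht (le_max_right j k)))

theorem point_mem_interval {t : ℝ} (ht : t ∈ Set.Ico (0 : ℝ) 1) (k : ℕ) :
    point D t ∈ D.interval k (address D t k) := by
  constructor
  · refine le_ciSup (f := fun k => D.left k (address D t k)) ⟨1, ?_⟩ k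
    rintro _ ⟨j, rfl⟩
    exact (h.left_le_right_address ht j 0).trans (by simp [right])
  · exact ciSup_le fun j => h.left_le_right_address ht j k

theorem point_mem_limitSet {t : ℝ} (ht : t ∈ Set.Ico (0 : ℝ) 1) : point D t ∈ D.limitSet := by
  refine Set.mem_iInter.2 fun k => ?_
  simp only [Set.mem_iUnion, exists_prop]
  exact ⟨_, h.address_lt ht k, h.point_mem_interval ht k⟩

theorem point_mem_interval_iff {t : ℝ} (ht : t ∈ Set.Ico (0 : ℝ) 1) {k i : ℕ}
    (hi : i < D.count k) : point D t ∈ D.interval k i ↔ address D t k = i := by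
  constructor
  · exact fun hp => h.eq_of_mem_interval (h.address_lt ht k) hi (h.point_mem_interval ht k) hp
  · rintro rfl
    exact h.point_mem_interval ht k

/-- Since `count k ≥ 2 ^ k`, two addresses are more than one cell apart at a deep enough level.
Their points then lie in different, hence disjoint, intervals. -/
theorem injOn_point : Set.InjOn (point D) (Set.Ico 0 1) := by
  have key : ∀ t ∈ Set.Ico (0 : ℝ) 1, ∀ t' ∈ Set.Ico (0 : ℝ) 1, t < t' →
      point D t ≠ point D t' := by
    intro t ht t' ht' hlt heq
    obtain ⟨k, hk⟩ := pow_unbounded_of_one_lt (1 / (t' - t)) (one_lt_two (α := ℝ))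
    have hpos : 0 < t' - t := by linarith
    rw [div_lt_iff₀ hpos] at hk
    have hc : (2 : ℝ) ^ k ≤ D.count k := by exact_mod_cast h.two_pow_le_count k
    have h1 : 1 ≤ (t' - t) * D.count k := by nlinarith
    have h2 : address D t k = address D t' k := by
      rw [← h.point_mem_interval_iff ht (h.address_lt ht' k), heq]
      exact h.point_mem_interval ht' k
    have h3 := Nat.floor_le (a := t * D.count k) (mul_nonneg ht.1 (by positivity))
    have h4 := Nat.lt_floor_add_one (t' * D.count k)
    rw [address, address] at h2
    rw [h2] at h3
    nlinarith
  intro t ht t' ht' heq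
  by_contra hne
  rcases lt_or_gt_of_ne hne with hlt | hlt
  · exact key t ht t' ht' hlt heq
  · exact key t' ht' t ht hlt heq.symm

theorem not_countable_limitSet : ¬ D.limitSet.Countable := by
  intro hc
  have h1 : (Set.Ico (0 : ℝ) 1).Countable :=
    Set.countable_of_injective_of_countable_image h.injOn_point
      (hc.mono (by rintro _ ⟨t, ht, rfl⟩; exact h.point_mem_limitSet ht))
  have h2 := h1.measure_zero volume
  simp at h2

omit h in
theorem measurable_point : Measurable (point D) := by
  refine Measurable.iSup fun k => ?_
  have h1 : Measurable (fun t : ℝ => address D t k) :=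
    Nat.measurable_floor.comp (measurable_id.mul_const _)
  exact (measurable_from_nat (f := D.left k)).comp h1

omit h in
theorem measurableSet_limitSet : MeasurableSet D.limitSet :=
  MeasurableSet.iInter fun _ => MeasurableSet.iUnion fun _ => MeasurableSet.iUnion fun _ =>
    measurableSet_Icc

/-- The image of the uniform distribution on the addresses is a natural measure. -/
theorem isNaturalMeasure_map_point :
    D.IsNaturalMeasure ((volume.restrict (Set.Ico (0 : ℝ) 1)).map (point D)) where
  isProbabilityMeasure := by
    constructor
    rw [Measure.map_apply measurable_point MeasurableSet.univ]
    simp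
  compl_limitSet := by
    rw [Measure.map_apply measurable_point measurableSet_limitSet.compl,
      Measure.restrict_apply (measurable_point measurableSet_limitSet.compl)]
    convert! measure_empty (μ := (volume : Measure ℝ))
    ext t
    simp only [Set.mem_inter_iff, Set.mem_preimage, Set.mem_compl_iff, Set.mem_empty_iff_false,
      iff_false, not_and]
    exact fun ht ht' => ht (h.point_mem_limitSet ht')
  interval k i hi := by
    have hm : MeasurableSet (D.interval k i) := measurableSet_Icc
    have hc : (0 : ℝ) < D.count k := by exact_mod_cast h.count_pos k
    rw [Measure.map_apply measurable_point hm, Measure.restrict_apply (measurable_point hm)]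
    -- The addresses leading to interval `i` form the `i`-th of `count k` equal cells of `[0, 1)`.
    have hset : point D ⁻¹' D.interval k i ∩ Set.Ico 0 1 =
        Set.Ico ((i : ℝ) / D.count k) (((i : ℝ) + 1) / D.count k) := by
      ext t
      simp only [Set.mem_inter_iff, Set.mem_preimage, Set.mem_Ico]
      have hi1 : ((i : ℝ) + 1) / D.count k ≤ 1 := by
        rw [div_le_one hc]; exact_mod_cast hi
      have hi0 : 0 ≤ (i : ℝ) / D.count k := by positivity
      have hiff : 0 ≤ t → (address D t k = i ↔
          (i : ℝ) / D.count k ≤ t ∧ t < ((i : ℝ) + 1) / D.count k) := by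
        intro ht
        rw [address, Nat.floor_eq_iff (mul_nonneg ht hc.le), div_le_iff₀ hc, lt_div_iff₀ hc]
      constructor
      · rintro ⟨h1, ht⟩
        rw [h.point_mem_interval_iff ht hi, hiff ht.1] at h1
        exact h1
      · rintro ⟨h1, h2⟩
        have ht : t ∈ Set.Ico (0 : ℝ) 1 := ⟨hi0.trans h1, h2.trans_le hi1⟩
        exact ⟨(h.point_mem_interval_iff ht hi).2 ((hiff ht.1).2 ⟨h1, h2⟩), ht⟩
    rw [hset, Real.volume_Ico, ← sub_div, add_sub_cancel_left, one_div,
      ENNReal.ofReal_inv_of_pos hc, ENNReal.ofReal_natCast]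

/-- A point of the limit set is computable if the numbers of the intervals it belongs to are. -/
theorem isComputableReal (hD : D.IsComputable) {x : ℝ} {i : ℕ → ℕ} (hi : Computable i)
    (hlt : ∀ k, i k < D.count k) (hx : ∀ k, x ∈ D.interval k (i k)) : IsComputableReal x := by
  -- At level `2 ^ j + 1` strict growth of `M` already gives `q > 2 ^ j`, and the radius is at most
  -- `1 / q`.
  have hlevel : Computable (fun j : ℕ => 2 ^ j + 1) :=
    Computable.succ.comp (Primrec.nat_pow.to_comp.comp (Computable.const 2) Computable.id)
  refine ⟨fun j => (D.p (2 ^ j + 1) (i (2 ^ j + 1)) : ℚ) / D.q (2 ^ j + 1) (i (2 ^ j + 1)),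
    ⟨fun j => ((D.p (2 ^ j + 1) (i (2 ^ j + 1)) : ℤ), D.q (2 ^ j + 1) (i (2 ^ j + 1)) - 1),
      ?_, fun j => ?_⟩, fun j => ?_⟩
  · exact (Primrec.int_natCast.to_comp.comp (hD.p.comp hlevel (hi.comp hlevel))).pair
      (Primrec.nat_sub.to_comp.comp (hD.q.comp hlevel (hi.comp hlevel)) (Computable.const 1))
  · have := (h.prime_q (2 ^ j + 1) (Nat.le_add_left _ _) _ (hlt _)).one_lt
    have h1 : (((D.q (2 ^ j + 1) (i (2 ^ j + 1)) - 1 : ℕ) : ℚ) + 1) =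
        D.q (2 ^ j + 1) (i (2 ^ j + 1)) := by
      exact_mod_cast Nat.sub_add_cancel this.le
    simp only [h1, Int.cast_natCast]
  · have hk : 1 ≤ 2 ^ j + 1 := Nat.le_add_left _ _
    have hx' := hx (2 ^ j + 1)
    have hq := h.lt_q _ hk _ (hlt (2 ^ j + 1))
    have hM := h.le_M (2 ^ j)
    have hb : (2 : ℝ) < D.b (2 ^ j + 1) := by exact_mod_cast h.two_lt_b _ hk
    set q := D.q (2 ^ j + 1) (i (2 ^ j + 1)) with hqdef
    have hq2 : (2 : ℝ) ^ j < q := by exact_mod_cast hM.trans_lt hq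
    have hq1 : (1 : ℝ) < q := lt_of_le_of_lt (one_le_pow₀ (by norm_num)) hq2
    have hr : (q : ℝ) ^ (-(D.b (2 ^ j + 1) : ℝ)) < 1 / 2 ^ j := by
      calc (q : ℝ) ^ (-(D.b (2 ^ j + 1) : ℝ)) ≤ (q : ℝ) ^ (-1 : ℝ) :=
            Real.rpow_le_rpow_of_exponent_le hq1.le (by linarith)
        _ = 1 / (q : ℝ) := by rw [Real.rpow_neg_one, one_div]
        _ < _ := one_div_lt_one_div_of_lt (by positivity) hq2
    simp only [interval, left, right, Set.mem_Icc] at hx'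
    rw [← hqdef] at hx'
    push_cast
    rw [abs_lt]
    constructor <;> linarith [hx'.1, hx'.2]

/-- At the address `1 / count (n + 1)` the interval numbers are the integer quotients `count k /
count (n + 1)`, which are computable in `k`. -/
theorem infinite_computable (hD : D.IsComputable) :
    {x : ℝ | x ∈ D.limitSet ∧ IsComputableReal x}.Infinite := by
  have hlt : ∀ n, 1 < D.count (n + 1) := fun n =>
    (Nat.one_lt_two_pow (by omega)).trans_le (h.two_pow_le_count (n + 1))
  have hmem : ∀ n, (1 : ℝ) / D.count (n + 1) ∈ Set.Ico (0 : ℝ) 1 := by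
    intro n
    have : (1 : ℝ) < D.count (n + 1) := by exact_mod_cast hlt n
    exact ⟨by positivity, by rw [div_lt_one (by linarith)]; exact this⟩
  refine Set.infinite_of_injective_forall_mem (f := fun n => point D (1 / D.count (n + 1))) ?_ ?_
  · intro n n' hnn
    have h1 := h.injOn_point (hmem n) (hmem n') hnn
    have hmono : StrictMono fun k => D.count (k + 1) :=
      strictMono_nat_of_lt_succ fun k => h.count_lt_count_succ (k + 1)
    apply hmono.injective
    simp only [one_div, inv_inj] at h1
    exact_mod_cast h1
  · intro n
    refine ⟨h.point_mem_limitSet (hmem n), ?_⟩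
    refine h.isComputableReal hD (i := fun k => D.count k / D.count (n + 1)) ?_ ?_ ?_
    · exact Primrec.nat_div.to_comp.comp (computable_count hD.m) (Computable.const _)
    · exact fun k => Nat.div_lt_self (h.count_pos k) (hlt n)
    · intro k
      have := h.point_mem_interval (hmem n) k
      rwa [address, one_div_mul_eq_div, Nat.floor_div_eq_div] at this

end IsCantorLike

end JarnikData

theorem countable_isComputableReal : {x : ℝ | IsComputableReal x}.Countable := by
  have hlim : ∀ (x y : ℝ) (r : ℕ → ℚ), (∀ j : ℕ, |x - (r j : ℝ)| < 1 / (2 : ℝ) ^ j) →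
      (∀ j : ℕ, |y - (r j : ℝ)| < 1 / (2 : ℝ) ^ j) → x = y := by
    intro x y r hx hy
    by_contra hne
    have hpos : 0 < |x - y| := abs_pos.2 (sub_ne_zero.2 hne)
    obtain ⟨j, hj⟩ := pow_unbounded_of_one_lt (2 / |x - y|) (one_lt_two (α := ℝ))
    rw [div_lt_iff₀ hpos] at hj
    have h1 := abs_sub_le x (r j : ℝ) y
    rw [abs_sub_comm (r j : ℝ) y] at h1
    have h2 : |x - y| < 2 / 2 ^ j := by
      have := hx j
      have := hy j
      have e : (2 : ℝ) / 2 ^ j = 1 / 2 ^ j + 1 / 2 ^ j := by ring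
      linarith
    rw [lt_div_iff₀ (by positivity)] at h2
    linarith
  have hfun : {f : ℕ → ℤ × ℕ | Computable f}.Countable := by
    -- Encoding the values reduces to the countability of the computable functions `ℕ → ℕ`.
    have hinj : Function.Injective (fun f : {f : ℕ → ℤ × ℕ // Computable f} =>
        (⟨fun n => Encodable.encode (f.1 n), Computable.encode.comp f.2⟩ :
          {f : ℕ → ℕ // Computable f})) := by
      intro f g hfg
      apply Subtype.ext
      funext n
      exact Encodable.encode_injective (congrFun (congrArg Subtype.val hfg) n)
    exact Set.countable_coe_iff.1 hinj.countable
  choose! r hr hrx using fun (x : ℝ) (hx : IsComputableReal x) => hx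
  choose! f hf hfr using fun (x : ℝ) (hx : IsComputableReal x) => hr x hx
  refine Set.countable_of_injective_of_countable_image (f := f) ?_
    (hfun.mono (by rintro _ ⟨x, hx, rfl⟩; exact hf x hx))
  intro x hx y hy hxy
  refine hlim x y (r x) (hrx x hx) fun j => ?_
  have : r x j = r y j := by rw [hfr x hx, hfr y hy, hxy]
  rw [this]
  exact hrx y hy j

/-! ### Closure properties of primitive recursive and computable functions. -/

section ComputabilityLemmas

variable {α β γ : Type*} [Primcodable α] [Primcodable β] [Primcodable γ]

attribute [fun_prop] Primrec Computable

@[fun_prop]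
theorem Primrec.id_fun : Primrec (fun x : α => x) := Primrec.id

@[fun_prop]
theorem Computable.id_fun : Computable (fun x : α => x) := Computable.id

attribute [fun_prop] Primrec.const Primrec.comp Primrec.pair Computable.const Computable.comp
  Computable.pair

@[fun_prop]
theorem Primrec.fst_fun {f : α → β × γ} (hf : Primrec f) : Primrec (fun x => (f x).1) :=
  Primrec.fst.comp hf

@[fun_prop]
theorem Primrec.snd_fun {f : α → β × γ} (hf : Primrec f) : Primrec (fun x => (f x).2) :=
  Primrec.snd.comp hf

@[fun_prop]
theorem Primrec.add_fun {f g : α → ℕ} (hf : Primrec f) (hg : Primrec g) :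
    Primrec (fun x => f x + g x) := Primrec.nat_add.comp hf hg

@[fun_prop]
theorem Primrec.sub_fun {f g : α → ℕ} (hf : Primrec f) (hg : Primrec g) :
    Primrec (fun x => f x - g x) := Primrec.nat_sub.comp hf hg

@[fun_prop]
theorem Primrec.mul_fun {f g : α → ℕ} (hf : Primrec f) (hg : Primrec g) :
    Primrec (fun x => f x * g x) := Primrec.nat_mul.comp hf hg

@[fun_prop]
theorem Primrec.pow_fun {f g : α → ℕ} (hf : Primrec f) (hg : Primrec g) :
    Primrec (fun x => f x ^ g x) := Primrec.nat_pow.comp hf hg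

@[fun_prop]
theorem Primrec.div_fun {f g : α → ℕ} (hf : Primrec f) (hg : Primrec g) :
    Primrec (fun x => f x / g x) := Primrec.nat_div.comp hf hg

@[fun_prop]
theorem Primrec.mod_fun {f g : α → ℕ} (hf : Primrec f) (hg : Primrec g) :
    Primrec (fun x => f x % g x) := Primrec.nat_mod.comp hf hg

@[fun_prop]
theorem Computable.fst_fun {f : α → β × γ} (hf : Computable f) : Computable (fun x => (f x).1) :=
  Computable.fst.comp hf

@[fun_prop]
theorem Computable.snd_fun {f : α → β × γ} (hf : Computable f) : Computable (fun x => (f x).2) :=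
  Computable.snd.comp hf

@[fun_prop]
theorem Computable.add_fun {f g : α → ℕ} (hf : Computable f) (hg : Computable g) :
    Computable (fun x => f x + g x) := Primrec.nat_add.to_comp.comp hf hg

@[fun_prop]
theorem Computable.sub_fun {f g : α → ℕ} (hf : Computable f) (hg : Computable g) :
    Computable (fun x => f x - g x) := Primrec.nat_sub.to_comp.comp hf hg

@[fun_prop]
theorem Computable.mul_fun {f g : α → ℕ} (hf : Computable f) (hg : Computable g) :
    Computable (fun x => f x * g x) := Primrec.nat_mul.to_comp.comp hf hg

@[fun_prop]
theorem Computable.pow_fun {f g : α → ℕ} (hf : Computable f) (hg : Computable g) :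
    Computable (fun x => f x ^ g x) := Primrec.nat_pow.to_comp.comp hf hg

@[fun_prop]
theorem Computable.div_fun {f g : α → ℕ} (hf : Computable f) (hg : Computable g) :
    Computable (fun x => f x / g x) := Primrec.nat_div.to_comp.comp hf hg

@[fun_prop]
theorem Computable.mod_fun {f g : α → ℕ} (hf : Computable f) (hg : Computable g) :
    Computable (fun x => f x % g x) := Primrec.nat_mod.to_comp.comp hf hg

theorem PrimrecPred.forall_lt_fun {R : ℕ → α → Prop} {f : α → ℕ} (hf : Primrec f)
    (hR : PrimrecPred fun z : ℕ × α => R z.1 z.2) : PrimrecPred fun a => ∀ x < f a, R x a := by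
  have h : PrimrecRel R := hR
  exact (h.forall_mem_list.comp (Primrec.list_range.comp hf) Primrec.id).of_eq (by simp)

theorem PrimrecPred.lt_fun {f g : α → ℕ} (hf : Primrec f) (hg : Primrec g) :
    PrimrecPred fun x => f x < g x := Primrec.nat_lt.comp hf hg

theorem PrimrecPred.le_fun {f g : α → ℕ} (hf : Primrec f) (hg : Primrec g) :
    PrimrecPred fun x => f x ≤ g x := Primrec.nat_le.comp hf hg

theorem PrimrecPred.imp {p q : α → Prop} (hp : PrimrecPred p) (hq : PrimrecPred q) :
    PrimrecPred fun x => p x → q x :=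
  (hp.not.or hq).of_eq fun x => by tauto

theorem PrimrecPred.nat_dvd {f g : α → ℕ} (hf : Primrec f) (hg : Primrec g) :
    PrimrecPred fun x => f x ∣ g x :=
  ((Primrec.eq (α := ℕ)).comp (Primrec.mod_fun hg hf) (Primrec.const 0)).of_eq
    fun _ => (Nat.dvd_iff_mod_eq_zero).symm

theorem PrimrecPred.nat_prime {f : α → ℕ} (hf : Primrec f) : PrimrecPred fun x => (f x).Prime := by
  have h : PrimrecPred fun x : α => 2 ≤ f x ∧ ∀ m < f x, m ∣ f x → m = 1 := by
    refine (PrimrecPred.le_fun (by fun_prop) hf).and (PrimrecPred.forall_lt_fun hf ?_)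
    exact (PrimrecPred.nat_dvd (by fun_prop) (by fun_prop)).imp
      ((Primrec.eq (α := ℕ)).comp Primrec.fst (Primrec.const 1))
  refine h.of_eq fun x => ?_
  rw [Nat.prime_def_lt]

theorem Primrec.nat_gcd : Primrec₂ Nat.gcd := by
  -- The sum bounds the divisor when one argument is zero, and it gives the right value `0` when
  -- both are.
  have h : Primrec (fun z : ℕ × ℕ => (z.1 + z.2).findGreatest fun d => d ∣ z.1 ∧ d ∣ z.2) := by
    refine Primrec.nat_findGreatest (p := fun (z : ℕ × ℕ) d => d ∣ z.1 ∧ d ∣ z.2) (by fun_prop) ?_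
    exact (PrimrecPred.nat_dvd (f := fun z : (ℕ × ℕ) × ℕ => z.2) (g := fun z => z.1.1)
      (by fun_prop) (by fun_prop)).and (PrimrecPred.nat_dvd (by fun_prop) (by fun_prop))
  refine h.of_eq fun z => ?_
  rw [Nat.findGreatest_eq_iff]
  refine ⟨?_, fun _ => ⟨Nat.gcd_dvd_left _ _, Nat.gcd_dvd_right _ _⟩, ?_⟩
  · rcases Nat.eq_zero_or_pos z.1 with h0 | h0
    · rw [h0, Nat.gcd_zero_left, zero_add]
    · exact (Nat.le_of_dvd h0 (Nat.gcd_dvd_left _ _)).trans (Nat.le_add_right _ _)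
  · rintro n hn hle ⟨h1, h2⟩
    have h3 := Nat.dvd_gcd h1 h2
    rcases Nat.eq_zero_or_pos (z.1.gcd z.2) with h0 | h0
    · rw [Nat.gcd_eq_zero_iff] at h0
      omega
    · exact absurd (Nat.le_of_dvd h0 h3) (by omega)

theorem Primrec.nat_factorial : Primrec Nat.factorial := by
  have h : Primrec (Nat.rec (motive := fun _ => ℕ) 1 fun n v => (n + 1) * v) :=
    Primrec.nat_rec₁ 1 (Primrec.mul_fun (f := fun z : ℕ × ℕ => z.1 + 1) (by fun_prop) (by fun_prop))
  refine h.of_eq fun n => ?_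
  induction n with
  | zero => rfl
  | succ n ih => rw [Nat.factorial_succ, ← ih]

@[fun_prop]
theorem Primrec.reducedDen {f g : α → ℕ} (hf : Primrec f) (hg : Primrec g) :
    Primrec (fun x => reducedDen (f x) (g x)) :=
  Primrec.div_fun hf (Primrec.nat_gcd.comp hg hf)

@[fun_prop]
theorem Primrec.reducedNum {f g : α → ℕ} (hf : Primrec f) (hg : Primrec g) :
    Primrec (fun x => reducedNum (f x) (g x)) :=
  Primrec.div_fun hg (Primrec.nat_gcd.comp hg hf)

end ComputabilityLemmas

/-! ### Computability of the construction. -/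

namespace JarnikConstruction

theorem primrec_goodChildren : Primrec
    (fun z : ℕ × ℕ × ℕ × ℕ × ℕ × ℕ × ℕ × ℕ => goodChildren z.1 z.2.1 z.2.2.1 z.2.2.2.1 z.2.2.2.2.1
      z.2.2.2.2.2.1 z.2.2.2.2.2.2.1 z.2.2.2.2.2.2.2) := by
  classical
  have h : PrimrecRel (fun (n : ℕ) (z : ℕ × ℕ × ℕ × ℕ × ℕ × ℕ × ℕ × ℕ) =>
      GoodChild z.1 z.2.1 z.2.2.1 z.2.2.2.1 z.2.2.2.2.1
        z.2.2.2.2.2.1 z.2.2.2.2.2.2.1 z.2.2.2.2.2.2.2 n) := by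
    unfold GoodChild
    refine PrimrecPred.and (.lt_fun (by fun_prop) (by fun_prop)) (.and (.nat_prime (by fun_prop))
      (.and (.lt_fun (by fun_prop) (by fun_prop)) (.and (.lt_fun (by fun_prop) (by fun_prop))
        (.and (.le_fun (by fun_prop) (by fun_prop)) (.forall_lt_fun (by fun_prop)
          (.imp (.le_fun (by fun_prop) (by fun_prop)) (.and (.le_fun (by fun_prop) (by fun_prop))
            (.le_fun (by fun_prop) (by fun_prop)))))))))
  refine (h.listFilter.comp (Primrec.list_range.comp (g := fun z => z.2.1) (by fun_prop))
    Primrec.id).of_eq fun z => ?_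
  unfold goodChildren
  congr

variable {B : ℕ} {u : ℕ → ℕ}

theorem primrec_scale : Primrec (scale B) := by
  unfold scale
  fun_prop

theorem primrec_commonDen : Primrec (commonDen B) := by
  unfold commonDen
  have := primrec_scale (B := B)
  exact Primrec.nat_factorial.comp (by fun_prop)

theorem computable_expo (hu : Computable u) : Computable (expo B u) := by
  unfold expo
  fun_prop

theorem computable_branch (hu : Computable u) : Computable (branch B u) := by
  unfold branch
  have h1 := (primrec_scale (B := B)).to_comp
  have h2 := computable_expo (B := B) hu
  fun_prop

theorem computable_children (hu : Computable u) : Computable₂ (children B u) := by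
  have h1 := (primrec_scale (B := B)).to_comp
  have h2 := computable_expo (B := B) hu
  have h3 := (primrec_commonDen (B := B)).to_comp
  exact primrec_goodChildren.to_comp.comp
    (g := fun z : ℕ × ℕ => (commonDen B z.1, commonDen B (z.1 + 1), 2 ^ scale B (z.1 + 1),
      expo B u z.1 + B, expo B u z.1 - scale B z.1 - 2,
      scale B (z.1 + 1) - slack B * (z.1 + 1), 2 ^ (slack B * (z.1 + 1)), z.2)) (by fun_prop)

/-- The ancestor of level `j` of the `i`-th interval of level `k`. -/
noncomputable def ancestor (B : ℕ) (u : ℕ → ℕ) (k i j : ℕ) : ℕ :=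
  Nat.rec 0 (fun j v => (children B u j v).getD
    (i / ((data B u).count k / (data B u).count (j + 1)) % branch B u (j + 1)) 0) j

/-- `node` changes its index at each recursive call, which is not primitive recursion. `ancestor`
descends from the root with `(k, i)` fixed, the index at level `j` being read off by one division.
-/
theorem ancestor_eq (h : Admissible B u) (k i : ℕ) : ∀ j ≤ k,
    ancestor B u k i j = node B u j (i / ((data B u).count k / (data B u).count j)) := by
  intro j
  induction j with
  | zero => intro _; rfl
  | succ j ih =>
    intro hj
    have hdvd : (data B u).count (j + 1) ∣ (data B u).count k :=
      Finset.prod_dvd_prod_of_subset _ _ _ (Finset.range_subset_range.2 hj)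
    have hpar : i / ((data B u).count k / (data B u).count (j + 1)) / branch B u (j + 1)
        = i / ((data B u).count k / (data B u).count j) := by
      rw [Nat.div_div_eq_div_mul]
      congr 1
      obtain ⟨c, hc⟩ := hdvd
      have h1 := count_pos h (j + 1)
      have h2 := count_pos h j
      rw [hc, Nat.mul_div_cancel_left _ h1, count_succ, mul_assoc, Nat.mul_div_cancel_left _ h2,
        mul_comm]
    rw [node, hpar, ← ih (by omega)]
    rfl

theorem ancestor_self (h : Admissible B u) (k i : ℕ) : ancestor B u k i k = node B u k i := by
  rw [ancestor_eq h k i k le_rfl, Nat.div_self (count_pos h k), Nat.div_one]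

theorem computable_count (hu : Computable u) : Computable (data B u).count :=
  JarnikData.computable_count (computable_branch hu)

theorem computable_node (h : Admissible B u) (hu : Computable u) : Computable₂ (node B u) := by
  have h1 := computable_branch (B := B) hu
  have h2 : Computable (data B u).count := computable_count hu
  have key : Computable (fun z : ℕ × ℕ => ancestor B u z.1 z.2 z.1) := by
    refine Computable.nat_rec (f := fun z : ℕ × ℕ => z.1) (g := fun _ => 0)
      (h := fun z w => (children B u w.1 w.2).getD
        (z.2 / ((data B u).count z.1 / (data B u).count (w.1 + 1)) % branch B u (w.1 + 1)) 0)
      (by fun_prop) (by fun_prop) ?_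
    refine (Primrec.list_getD 0).to_comp.comp
      (g := fun x : (ℕ × ℕ) × ℕ × ℕ => children B u x.2.1 x.2.2) ?_ (by fun_prop)
    exact (computable_children hu).comp (g := fun x : (ℕ × ℕ) × ℕ × ℕ => x.2.1) (by fun_prop)
      (by fun_prop)
  exact key.of_eq fun z => ancestor_self h z.1 z.2

theorem isComputable (h : Admissible B u) (hu : Computable u) : (data B u).IsComputable := by
  have h1 := (primrec_scale (B := B)).to_comp
  have h3 := (primrec_commonDen (B := B)).to_comp
  have h4 : Computable (fun z : ℕ × ℕ => node B u z.1 z.2) := computable_node h hu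
  refine ⟨computable_branch hu, ?_, ?_, ?_, ?_⟩
  · exact (by fun_prop : Computable fun k => 2 ^ scale B k)
  · refine ⟨fun k => ((u k : ℤ), k - 1), ?_, fun k => ?_⟩
    · exact (Primrec.int_natCast.to_comp.comp hu).pair (by fun_prop)
    · simp [data]
  · exact (Primrec.reducedNum (f := fun z : ℕ × ℕ => z.1) (g := fun z => z.2) (by fun_prop)
      (by fun_prop)).to_comp.comp (g := fun z : ℕ × ℕ => (commonDen B z.1, node B u z.1 z.2))
      (by fun_prop)
  · exact (Primrec.reducedDen (f := fun z : ℕ × ℕ => z.1) (g := fun z => z.2) (by fun_prop)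
      (by fun_prop)).to_comp.comp (g := fun z : ℕ × ℕ => (commonDen B z.1, node B u z.1 z.2))
      (by fun_prop)

end JarnikConstruction

/-! ### Functions recursive in the halting problem have `Σ₂` graphs. -/

section SigmaTwo

variable {α β : Type*} [Primcodable α] [Primcodable β]

/-- `Σ₂` predicates. -/
def IsSigmaTwo (P : α → Prop) : Prop :=
  ∃ R : α × ℕ × ℕ → Prop, PrimrecPred R ∧ ∀ x, P x ↔ ∃ s, ∀ t, R (x, s, t)

namespace IsSigmaTwo

theorem of_eq {P Q : α → Prop} (hP : IsSigmaTwo P) (h : ∀ x, P x ↔ Q x) : IsSigmaTwo Q := by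
  obtain ⟨R, hR, hPR⟩ := hP
  exact ⟨R, hR, fun x => (h x).symm.trans (hPR x)⟩

theorem of_primrecPred {P : α → Prop} (hP : PrimrecPred P) : IsSigmaTwo P :=
  ⟨fun z => P z.1, hP.comp Primrec.fst, fun x => by simp⟩

theorem comp {P : β → Prop} (hP : IsSigmaTwo P) {f : α → β} (hf : Primrec f) :
    IsSigmaTwo fun x => P (f x) := by
  obtain ⟨R, hR, hPR⟩ := hP
  exact ⟨fun z => R (f z.1, z.2), hR.comp (by fun_prop), fun x => hPR (f x)⟩

theorem and {P Q : α → Prop} (hP : IsSigmaTwo P) (hQ : IsSigmaTwo Q) :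
    IsSigmaTwo fun x => P x ∧ Q x := by
  obtain ⟨R, hR, hPR⟩ := hP
  obtain ⟨S, hS, hQS⟩ := hQ
  have hu : Primrec fun z : α × ℕ × ℕ => Nat.unpair z.2.1 := Primrec.unpair.comp (by fun_prop)
  refine ⟨fun z => R (z.1, z.2.1.unpair.1, z.2.2) ∧ S (z.1, z.2.1.unpair.2, z.2.2),
    (hR.comp (by fun_prop)).and (hS.comp (by fun_prop)), fun x => ?_⟩
  simp only [hPR, hQS]
  constructor
  · rintro ⟨⟨s, hs⟩, s', hs'⟩
    exact ⟨Nat.pair s s', fun t => by simpa using ⟨hs t, hs' t⟩⟩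
  · rintro ⟨s, hs⟩
    exact ⟨⟨_, fun t => (hs t).1⟩, _, fun t => (hs t).2⟩

theorem exists_nat {P : α → ℕ → Prop} (hP : IsSigmaTwo fun z : α × ℕ => P z.1 z.2) :
    IsSigmaTwo fun x => ∃ n, P x n := by
  obtain ⟨R, hR, hPR⟩ := hP
  have hu : Primrec fun z : α × ℕ × ℕ => Nat.unpair z.2.1 := Primrec.unpair.comp (by fun_prop)
  refine ⟨fun z => R ((z.1, z.2.1.unpair.1), z.2.1.unpair.2, z.2.2), hR.comp (by fun_prop),
    fun x => ?_⟩
  constructor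
  · rintro ⟨n, hn⟩
    obtain ⟨s, hs⟩ := (hPR (x, n)).1 hn
    exact ⟨Nat.pair n s, fun t => by simpa using hs t⟩
  · rintro ⟨s, hs⟩
    exact ⟨s.unpair.1, (hPR (x, s.unpair.1)).2 ⟨s.unpair.2, hs⟩⟩

/-- The `n`-th entry of the list with the given code. -/
def entry (l n : ℕ) : ℕ := (Denumerable.ofNat (List ℕ) l).getD n 0

theorem primrec_entry {f g : α → ℕ} (hf : Primrec f) (hg : Primrec g) :
    Primrec fun x => entry (f x) (g x) :=
  (Primrec.list_getD 0).comp ((Primrec.ofNat (List ℕ)).comp hf) hg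

theorem exists_entry_eq (g : ℕ → ℕ) (n : ℕ) : ∃ l, ∀ m < n, entry l m = g m := by
  refine ⟨Encodable.encode ((List.range n).map g), fun m hm => ?_⟩
  rw [entry, Denumerable.ofNat_encode, List.getD_eq_getElem _ _ (by simpa using hm)]
  simp

attribute [irreducible] entry

/-- The finitely many witnesses are collected in the code of one list, and the bounded quantifier is
merged with the inner universal one by pairing. -/
theorem forall_lt {P : α → ℕ → Prop} (hP : IsSigmaTwo fun z : α × ℕ => P z.1 z.2) {f : α → ℕ}
    (hf : Primrec f) : IsSigmaTwo fun x => ∀ n < f x, P x n := by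
  obtain ⟨R, hR, hPR⟩ := hP
  have hu : Primrec fun z : α × ℕ × ℕ => Nat.unpair z.2.2 := Primrec.unpair.comp (by fun_prop)
  refine ⟨fun z => z.2.2.unpair.1 < f z.1 →
    R ((z.1, z.2.2.unpair.1), entry z.2.1 z.2.2.unpair.1, z.2.2.unpair.2), ?_, fun x => ?_⟩
  · refine (PrimrecPred.lt_fun (by fun_prop) (by fun_prop)).imp (hR.comp ?_)
    have := primrec_entry (f := fun z : α × ℕ × ℕ => z.2.1) (g := fun z => z.2.2.unpair.1)
      (by fun_prop) (by fun_prop)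
    fun_prop
  · constructor
    · intro h
      choose! s hs using fun n hn => (hPR (x, n)).1 (h n hn)
      obtain ⟨l, hl⟩ := exists_entry_eq s (f x)
      refine ⟨l, fun t ht => ?_⟩
      simp only at ht ⊢
      rw [hl _ ht]
      exact hs _ ht _
    · rintro ⟨l, hl⟩ n hn
      refine (hPR (x, n)).2 ⟨entry l n, fun t => ?_⟩
      have := hl (Nat.pair n t)
      simp only [Nat.unpair_pair] at this
      exact this hn

theorem mem_comp {f : ℕ →. ℕ} (hf : IsSigmaTwo fun z : ℕ × ℕ => z.2 ∈ f z.1) {g₁ g₂ : α → ℕ}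
    (h₁ : Primrec g₁) (h₂ : Primrec g₂) : IsSigmaTwo fun x => g₂ x ∈ f (g₁ x) :=
  comp (P := fun z : ℕ × ℕ => z.2 ∈ f z.1) hf (f := fun x => (g₁ x, g₂ x)) (h₁.pair h₂)

end IsSigmaTwo

/-- The value `1` is certified by a number of steps `s` within which the program halts; the value
`0` says that it halts within no `t` steps. -/
theorem isSigmaTwo_mem_zeroJump : IsSigmaTwo fun z : ℕ × ℕ => z.2 ∈ zeroJump z.1 := by
  have hev : ∀ f : (ℕ × ℕ) × ℕ × ℕ → ℕ, Primrec f → Primrec fun z : (ℕ × ℕ) × ℕ × ℕ =>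
      (Nat.Partrec.Code.evaln (f z) (Denumerable.ofNat Nat.Partrec.Code z.1.1) z.1.1).isSome := by
    intro f hf
    have hc : Primrec fun z : (ℕ × ℕ) × ℕ × ℕ => Denumerable.ofNat Nat.Partrec.Code z.1.1 :=
      (Primrec.ofNat _).comp (by fun_prop)
    exact Primrec.option_isSome.comp (Nat.Partrec.Code.primrec_evaln.comp
      (g := fun z : (ℕ × ℕ) × ℕ × ℕ => ((f z, Denumerable.ofNat Nat.Partrec.Code z.1.1), z.1.1))
      (by fun_prop))
  have hdom : ∀ n, ((Denumerable.ofNat Nat.Partrec.Code n).eval n).Dom ↔ ∃ s,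
      (Nat.Partrec.Code.evaln s (Denumerable.ofNat Nat.Partrec.Code n) n).isSome = true := by
    intro n
    rw [Part.dom_iff_mem]
    simp only [Nat.Partrec.Code.evaln_complete, Option.isSome_iff_exists, Option.mem_def]
    exact exists_comm
  refine ⟨fun z => (z.1.2 = 1 ∧ (Nat.Partrec.Code.evaln z.2.1
      (Denumerable.ofNat Nat.Partrec.Code z.1.1) z.1.1).isSome = true) ∨
    (z.1.2 = 0 ∧ (Nat.Partrec.Code.evaln z.2.2
      (Denumerable.ofNat Nat.Partrec.Code z.1.1) z.1.1).isSome = false), ?_, ?_⟩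
  · refine ((Primrec.eq.comp ?_ (Primrec.const 1)).and
      (Primrec.eq.comp (hev _ ?_) (Primrec.const true))).or
      ((Primrec.eq.comp ?_ (Primrec.const 0)).and
      (Primrec.eq.comp (hev _ ?_) (Primrec.const false))) <;> fun_prop
  · rintro ⟨n, y⟩
    simp only [zeroJump, Part.mem_some_iff]
    split_ifs with h
    · obtain ⟨s, hs⟩ := (hdom n).1 h
      constructor
      · rintro rfl
        exact ⟨s, fun t => Or.inl ⟨rfl, hs⟩⟩
      · rintro ⟨s', h'⟩
        rcases h' s with h1 | h1
        · exact h1.1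
        · rw [hs] at h1; exact absurd h1.2 (by simp)
    · rw [hdom] at h
      push Not at h
      constructor
      · rintro rfl
        exact ⟨0, fun t => Or.inr ⟨rfl, by simpa using h t⟩⟩
      · rintro ⟨s, h'⟩
        rcases h' 0 with h1 | h1
        · exact absurd h1.2 (h s)
        · exact h1.1

/-- A computation by primitive recursion is witnessed by the list of its intermediate values, each
step of which is `Σ₂`. -/
theorem isSigmaTwo_graph_prec {f h : ℕ →. ℕ} (ihf : IsSigmaTwo fun z : ℕ × ℕ => z.2 ∈ f z.1)
    (ihh : IsSigmaTwo fun z : ℕ × ℕ => z.2 ∈ h z.1) :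
    IsSigmaTwo fun z : ℕ × ℕ => z.2 ∈ (let (a, n) := Nat.unpair z.1
      n.rec (f a) fun y IH => do
        let i ← IH
        h (Nat.pair a (Nat.pair y i)) : Part ℕ) := by
  have hun : Primrec fun z : (ℕ × ℕ) × ℕ => z.1.1.unpair := Primrec.unpair.comp (by fun_prop)
  have hun' : Primrec fun z : ((ℕ × ℕ) × ℕ) × ℕ => z.1.1.1.unpair :=
    Primrec.unpair.comp (by fun_prop)
  have he₀ := IsSigmaTwo.primrec_entry (f := fun z : (ℕ × ℕ) × ℕ => z.2) (g := fun _ => 0)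
    (by fun_prop) (by fun_prop)
  have h1 := ihf.mem_comp (g₁ := fun z : (ℕ × ℕ) × ℕ => z.1.1.unpair.1)
    (g₂ := fun z => IsSigmaTwo.entry z.2 0) (Primrec.fst.comp hun) he₀
  have he₁ := IsSigmaTwo.primrec_entry (f := fun z : ((ℕ × ℕ) × ℕ) × ℕ => z.1.2)
    (g := fun z => z.2) (by fun_prop) (by fun_prop)
  have he₂ := IsSigmaTwo.primrec_entry (f := fun z : ((ℕ × ℕ) × ℕ) × ℕ => z.1.2)
    (g := fun z => z.2 + 1) (by fun_prop) (by fun_prop)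
  have hp : Primrec fun z : ((ℕ × ℕ) × ℕ) × ℕ =>
      Nat.pair z.1.1.1.unpair.1 (Nat.pair z.2 (IsSigmaTwo.entry z.1.2 z.2)) :=
    Primrec₂.natPair.comp (Primrec.fst.comp hun') (Primrec₂.natPair.comp (by fun_prop) he₁)
  have h2 := ihh.mem_comp hp he₂
  have h3 := IsSigmaTwo.forall_lt (P := fun (z : (ℕ × ℕ) × ℕ) m =>
    IsSigmaTwo.entry z.2 (m + 1) ∈
      h (Nat.pair z.1.1.unpair.1 (Nat.pair m (IsSigmaTwo.entry z.2 m)))) h2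
    (f := fun z => z.1.1.unpair.2) (Primrec.snd.comp hun)
  have he₃ := IsSigmaTwo.primrec_entry (f := fun z : (ℕ × ℕ) × ℕ => z.2)
    (g := fun z => z.1.1.unpair.2) (by fun_prop) (Primrec.snd.comp hun)
  have h4 : PrimrecPred fun z : (ℕ × ℕ) × ℕ => IsSigmaTwo.entry z.2 z.1.1.unpair.2 = z.1.2 :=
    Primrec.eq.comp he₃ (by fun_prop)
  refine (IsSigmaTwo.exists_nat (P := fun (z : ℕ × ℕ) l =>
    IsSigmaTwo.entry l 0 ∈ f z.1.unpair.1 ∧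
    (∀ m < z.1.unpair.2, IsSigmaTwo.entry l (m + 1) ∈
      h (Nat.pair z.1.unpair.1 (Nat.pair m (IsSigmaTwo.entry l m)))) ∧
    IsSigmaTwo.entry l z.1.unpair.2 = z.2)
    (h1.and (h3.and (IsSigmaTwo.of_primrecPred h4)))).of_eq fun z => ?_
  obtain ⟨x, y⟩ := z
  simp only
  generalize x.unpair.1 = a
  generalize x.unpair.2 = n
  constructor
  · rintro ⟨l, h0, hm, rfl⟩
    have key : ∀ m ≤ n, IsSigmaTwo.entry l m ∈ (Nat.rec (f a) (fun y IH => do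
        let i ← IH
        h (Nat.pair a (Nat.pair y i))) m : Part ℕ) := by
      intro m
      induction m with
      | zero => exact fun _ => h0
      | succ m ih =>
        intro hmn
        exact Part.mem_bind_iff.2 ⟨_, ih (by omega), hm m (by omega)⟩
    exact key n le_rfl
  · intro hy
    have key : ∀ n y, y ∈ (Nat.rec (f a) (fun y IH => do
        let i ← IH
        h (Nat.pair a (Nat.pair y i))) n : Part ℕ) → ∃ g : ℕ → ℕ, g 0 ∈ f a ∧
        (∀ m < n, g (m + 1) ∈ h (Nat.pair a (Nat.pair m (g m)))) ∧ g n = y := by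
      intro n
      induction n with
      | zero => exact fun y hy => ⟨fun _ => y, hy, by simp, rfl⟩
      | succ n ih =>
        intro y hy
        obtain ⟨i, hi, hyi⟩ := Part.mem_bind_iff.1 hy
        obtain ⟨g, hg0, hgm, rfl⟩ := ih i hi
        refine ⟨fun m => if m ≤ n then g m else y, by simpa using hg0, fun m hm => ?_, by simp⟩
        rcases Nat.lt_or_ge m n with hmn | hmn
        · simp only [show m + 1 ≤ n by omega, hmn.le, if_true]
          exact hgm m hmn
        · obtain rfl : m = n := by omega
          simpa using hyi
    obtain ⟨g, hg0, hgm, hgn⟩ := key n y hy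
    obtain ⟨l, hl⟩ := IsSigmaTwo.exists_entry_eq g (n + 1)
    refine ⟨l, by rwa [hl 0 (by omega)], fun m hm => ?_, by rw [hl n (by omega), hgn]⟩
    rw [hl _ (by omega), hl _ (by omega)]
    exact hgm m hm

/-- The graph of a partial function that is recursive in the halting problem is `Σ₂`. -/
theorem isSigmaTwo_graph {f : ℕ →. ℕ} (hf : Nat.RecursiveIn {zeroJump} f) :
    IsSigmaTwo fun z : ℕ × ℕ => z.2 ∈ f z.1 := by
  have hunpair₁ : Primrec fun z : ℕ × ℕ => z.1.unpair := Primrec.unpair.comp (by fun_prop)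
  have hunpair₂ : Primrec fun z : ℕ × ℕ => z.2.unpair := Primrec.unpair.comp (by fun_prop)
  induction hf with
  | zero =>
    exact (IsSigmaTwo.of_primrecPred (Primrec.eq.comp Primrec.snd (Primrec.const 0))).of_eq
      fun z => (Part.mem_some_iff).symm
  | succ =>
    exact (IsSigmaTwo.of_primrecPred (Primrec.eq.comp Primrec.snd
      (Primrec.succ.comp Primrec.fst))).of_eq fun z => (Part.mem_some_iff).symm
  | left =>
    exact (IsSigmaTwo.of_primrecPred (Primrec.eq.comp Primrec.snd
      (Primrec.fst.comp hunpair₁))).of_eq fun z => (Part.mem_some_iff).symm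
  | right =>
    exact (IsSigmaTwo.of_primrecPred (Primrec.eq.comp Primrec.snd
      (Primrec.snd.comp hunpair₁))).of_eq fun z => (Part.mem_some_iff).symm
  | oracle g hg =>
    rw [Set.mem_singleton_iff] at hg
    subst hg
    exact isSigmaTwo_mem_zeroJump
  | @pair f h _ _ ihf ihh =>
    have h1 := ihf.comp (f := fun z : ℕ × ℕ => (z.1, z.2.unpair.1)) (by fun_prop)
    have h2 := ihh.comp (f := fun z : ℕ × ℕ => (z.1, z.2.unpair.2)) (by fun_prop)
    refine (h1.and h2).of_eq fun z => ?_
    simp only [Seq.seq, Part.mem_bind_iff, Part.map_eq_map, Part.mem_map_iff]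
    constructor
    · rintro ⟨ha, hb⟩
      exact ⟨_, ⟨_, ha, rfl⟩, _, hb, Nat.pair_unpair z.2⟩
    · rintro ⟨_, ⟨a, ha, rfl⟩, b, hb, hab⟩
      rw [← hab, Nat.unpair_pair]
      exact ⟨ha, hb⟩
  | @comp f h _ _ ihf ihh =>
    have h1 := ihh.comp (f := fun z : (ℕ × ℕ) × ℕ => (z.1.1, z.2)) (by fun_prop)
    have h2 := ihf.comp (f := fun z : (ℕ × ℕ) × ℕ => (z.2, z.1.2)) (by fun_prop)
    refine (IsSigmaTwo.exists_nat (P := fun (z : ℕ × ℕ) w => w ∈ h z.1 ∧ z.2 ∈ f w)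
      (h1.and h2)).of_eq fun z => ?_
    exact Part.mem_bind_iff.symm
  | prec _ _ ihf ihh => exact isSigmaTwo_graph_prec ihf ihh
  | @rfind f _ ihf =>
    have hp : Primrec fun z : ℕ × ℕ => Nat.pair z.1 z.2 :=
      Primrec₂.natPair.comp (by fun_prop) (by fun_prop)
    have h1 := ihf.comp (f := fun z : ℕ × ℕ => (Nat.pair z.1 z.2, 0)) (by fun_prop)
    have hp' : Primrec fun z : ((ℕ × ℕ) × ℕ) × ℕ => Nat.pair z.1.1.1 z.1.2 :=
      Primrec₂.natPair.comp (by fun_prop) (by fun_prop)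
    have h2 := ihf.comp (f := fun z : ((ℕ × ℕ) × ℕ) × ℕ => (Nat.pair z.1.1.1 z.1.2, z.2 + 1))
      (by fun_prop)
    have h3 := IsSigmaTwo.forall_lt (P := fun (z : ℕ × ℕ) m => ∃ v, v + 1 ∈ f (Nat.pair z.1 m))
      (IsSigmaTwo.exists_nat (P := fun (z : (ℕ × ℕ) × ℕ) v => v + 1 ∈ f (Nat.pair z.1.1 z.2)) h2)
      (f := fun z => z.2) (by fun_prop)
    refine (h1.and h3).of_eq fun z => ?_
    refine Iff.trans ?_ Nat.mem_rfind.symm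
    simp only [Part.map_eq_map, Part.mem_map_iff]
    refine and_congr ?_ (forall_congr' fun m => ?_)
    · simp
    · constructor
      · intro hm hlt
        obtain ⟨v, hv⟩ := hm hlt
        exact ⟨v + 1, hv, by simp⟩
      · intro hm hlt
        obtain ⟨v, hv, hv0⟩ := hm hlt
        have : v ≠ 0 := by simpa using hv0
        exact ⟨v - 1, by rwa [Nat.sub_add_cancel (by omega)]⟩

theorem isSigmaTwo_dom {f : α →. β} (hf : RecursiveIn {zeroJump} f) :
    IsSigmaTwo fun x => (f x).Dom := by
  have h1 := (isSigmaTwo_graph hf).comp (f := fun z : α × ℕ => (Encodable.encode z.1, z.2))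
    (Primrec.pair (Primrec.encode.comp Primrec.fst) Primrec.snd)
  -- `RecursiveIn` speaks of the function transported to `ℕ` by encoding; its domain at the code of
  -- `x` is that of `f` at `x`.
  refine (IsSigmaTwo.exists_nat (P := fun (x : α) y =>
    y ∈ Part.bind (Encodable.decode (α := α) (Encodable.encode x) : Part α)
      fun a => (f a).map Encodable.encode) h1).of_eq fun x => ?_
  simp only [Encodable.encodek, Part.coe_some, Part.bind_some, Part.mem_map_iff, Part.dom_iff_mem]
  constructor
  · rintro ⟨_, y, hy, -⟩
    exact ⟨y, hy⟩
  · rintro ⟨y, hy⟩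
    exact ⟨_, y, hy, rfl⟩

end SigmaTwo

theorem IsRightCEInZeroJump.isSigmaTwo {a : ℝ} (ha : IsRightCEInZeroJump a) :
    IsSigmaTwo fun z : ℕ × ℕ => a < (z.1 : ℝ) / ((z.2 : ℝ) + 1) := by
  obtain ⟨f, hf, hfa⟩ := ha
  have hp : Primrec fun z : ℕ × ℕ => ((z.1 : ℤ), z.2) :=
    Primrec.pair (Primrec.int_natCast.comp Primrec.fst) Primrec.snd
  refine ((isSigmaTwo_dom hf).comp hp).of_eq fun z => ?_
  rw [hfa, Int.cast_natCast]

/-! ### True stages of a `Σ₂` approximation. -/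

namespace TrueStages

/-- The `e`-th clause is a true one: none of its instances fails. -/
def Holds (R : ℕ → ℕ → Prop) (e : ℕ) : Prop := ∀ t, R e t

/-- At stage `k`, the clause `e` has not failed yet, and no clause with a smaller number fails for
the first time. -/
def Selected (R : ℕ → ℕ → Prop) (k e : ℕ) : Prop :=
  (∀ t < k + 1, R e t) ∧ ∀ e' < e, (∀ t < k, R e' t) → R e' k

/-- Each of the finitely many smaller clauses fails for the first time at most once. -/
theorem Holds.eventually_selected {R : ℕ → ℕ → Prop} {e : ℕ} (he : Holds R e) :
    ∃ K, ∀ k ≥ K, Selected R k e := by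
  have h : ∀ e', ∃ K, ∀ k ≥ K, (∀ t < k, R e' t) → R e' k := by
    intro e'
    by_cases h : ∀ t, R e' t
    · exact ⟨0, fun k _ _ => h k⟩
    · push Not at h
      obtain ⟨t, ht⟩ := h
      exact ⟨t + 1, fun k hk hR => absurd (hR t hk) ht⟩
  choose K hK using h
  refine ⟨∑ i ∈ Finset.range e, K i, fun k hk => ⟨fun t _ => he t, fun e' he' => hK e' k ?_⟩⟩
  exact (Finset.single_le_sum (fun _ _ => Nat.zero_le _) (Finset.mem_range.2 he')).trans hk

/-- There are infinitely many stages at which all the selected clauses hold. -/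
theorem exists_true_stage (R : ℕ → ℕ → Prop) (K : ℕ) :
    ∃ k ≥ K, ∀ e < k, Selected R k e → Holds R e := by
  classical
  have hdie : ∀ e k, Selected R k e → ¬ Holds R e → ∃ k' > k, (∀ t < k', R e t) ∧ ¬ R e k' := by
    intro e k hs hn
    simp only [Holds, not_forall] at hn
    refine ⟨Nat.find hn, ?_, fun t ht => not_not.1 (Nat.find_min hn ht), Nat.find_spec hn⟩
    by_contra! hc
    exact Nat.find_spec hn (hs.1 _ (Nat.lt_succ_of_le hc))
  -- Take the least clause `e₀` that first fails at some stage `k ≥ K` with `e₀ < k`. A false clause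
  -- selected at `k` first fails later, so it is not below `e₀` by minimality. It is not `e₀` or
  -- above, since selection forbids the failure of `e₀` at `k`. If there is no such `e₀`, stage `K`
  -- itself works.
  by_cases hex : ∃ e, ∃ k ≥ K, e < k ∧ (∀ t < k, R e t) ∧ ¬ R e k
  · obtain ⟨k, hk, hek, ha, hd⟩ := Nat.find_spec hex
    refine ⟨k, hk, fun e he hs => ?_⟩
    by_contra hn
    obtain ⟨k', hk', ha', hd'⟩ := hdie e k hs hn
    rcases lt_trichotomy e (Nat.find hex) with hlt | heq | hgt
    · exact Nat.find_min hex hlt ⟨k', by omega, by omega, ha', hd'⟩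
    · exact hd (heq ▸ hs.1 k (Nat.lt_succ_self k))
    · exact hd (hs.2 _ hgt ha)
  · refine ⟨K, le_rfl, fun e he hs => ?_⟩
    by_contra hn
    obtain ⟨k', hk', ha', hd'⟩ := hdie e K hs hn
    exact hex ⟨e, k', by omega, by omega, ha', hd'⟩

end TrueStages

/-! ### The computable sequence of exponents. -/

open Classical in
/-- The largest number up to `B * k` that is compatible with all the selected clauses. -/
noncomputable def stageBound (B : ℕ) (R : ℕ → ℕ → Prop) (val : ℕ → ℕ → ℕ) (k : ℕ) : ℕ :=
  Nat.findGreatest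
    (fun v => ∀ e < k, TrueStages.Selected R k e → v ≤ max (2 * k + 1) (val k e)) (B * k)

theorem stageBound_spec (B : ℕ) (R : ℕ → ℕ → Prop) (val : ℕ → ℕ → ℕ) {k e : ℕ} (he : e < k)
    (hs : TrueStages.Selected R k e) : stageBound B R val k ≤ max (2 * k + 1) (val k e) := by
  classical
  unfold stageBound
  exact Nat.findGreatest_spec
    (P := fun v => ∀ e < k, TrueStages.Selected R k e → v ≤ max (2 * k + 1) (val k e))
    (Nat.zero_le _) (fun _ _ _ => Nat.zero_le _) e he hs

theorem le_stageBound {B : ℕ} {R : ℕ → ℕ → Prop} {val : ℕ → ℕ → ℕ} {k v : ℕ} (hv : v ≤ B * k)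
    (h : ∀ e < k, TrueStages.Selected R k e → v ≤ max (2 * k + 1) (val k e)) :
    v ≤ stageBound B R val k := by
  classical
  unfold stageBound
  exact Nat.le_findGreatest hv h

/-- The lower limit `2 k + 1` on every clause's bound keeps the exponents above `2`; `B ≥ 3` makes
it compatible with the upper limit `B k`. -/
theorem admissible_stageBound {B : ℕ} (hB : 3 ≤ B) (R : ℕ → ℕ → Prop) (val : ℕ → ℕ → ℕ) :
    JarnikConstruction.Admissible B (stageBound B R val) where
  le k := by
    classical
    unfold stageBound
    exact Nat.findGreatest_le _
  lt k hk := by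
    have : 3 * k ≤ B * k := Nat.mul_le_mul_right _ hB
    exact le_stageBound (by omega) fun e _ _ => le_max_left _ _

theorem primrec_stageBound (B : ℕ) {R : ℕ → ℕ → Prop} {val : ℕ → ℕ → ℕ}
    (hR : PrimrecPred fun z : ℕ × ℕ => R z.1 z.2)
    (hval : Primrec fun z : ℕ × ℕ => val z.1 z.2) : Primrec (stageBound B R val) := by
  classical
  have halive : PrimrecPred fun z : ℕ × ℕ => ∀ t < z.1, R z.2 t :=
    .forall_lt_fun (R := fun t (z : ℕ × ℕ) => R z.2 t) (by fun_prop)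
      (hR.comp (f := fun w : ℕ × ℕ × ℕ => (w.2.2, w.1)) (by fun_prop))
  have hsel : PrimrecPred fun z : ℕ × ℕ => TrueStages.Selected R z.1 z.2 := by
    refine (halive.comp (f := fun z : ℕ × ℕ => (z.1 + 1, z.2)) (by fun_prop)).and ?_
    refine .forall_lt_fun (R := fun e' (z : ℕ × ℕ) => (∀ t < z.1, R e' t) → R e' z.1)
      (by fun_prop) (.imp ?_ ?_)
    · exact halive.comp (f := fun w : ℕ × ℕ × ℕ => (w.2.1, w.1)) (by fun_prop)
    · exact hR.comp (f := fun w : ℕ × ℕ × ℕ => (w.1, w.2.1)) (by fun_prop)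
  have hrel : PrimrecRel fun (k v : ℕ) =>
      ∀ e < k, TrueStages.Selected R k e → v ≤ max (2 * k + 1) (val k e) := by
    refine PrimrecPred.forall_lt_fun (α := ℕ × ℕ) (f := fun z => z.1) (R := fun e z =>
      TrueStages.Selected R z.1 e → z.2 ≤ max (2 * z.1 + 1) (val z.1 e)) (by fun_prop) (.imp ?_ ?_)
    · exact hsel.comp (f := fun w : ℕ × ℕ × ℕ => (w.2.1, w.1)) (by fun_prop)
    · refine .le_fun (by fun_prop) (Primrec.nat_max.comp (by fun_prop) ?_)
      exact hval.comp (g := fun w : ℕ × ℕ × ℕ => (w.2.1, w.1)) (by fun_prop)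
  unfold stageBound
  exact Primrec.nat_findGreatest (f := fun k => B * k) (by fun_prop) hrel

/-- A real number that is right-computably enumerable in `0'` is the limit superior of a computable
sequence of rational numbers with controlled denominators. -/
theorem IsRightCEInZeroJump.exists_computable {a : ℝ} (ha : 2 ≤ a) (hce : IsRightCEInZeroJump a) :
    ∃ (B : ℕ) (u : ℕ → ℕ), JarnikConstruction.Admissible B u ∧ Computable u ∧
      (∀ ε : ℝ, 0 < ε → ∃ K : ℕ, ∀ k ≥ K, (u k : ℝ) ≤ (a + ε) * k) ∧
      ∀ K : ℕ, ∃ k ≥ K, a * k ≤ u k := by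
  obtain ⟨R, hR, hRa⟩ := hce.isSigmaTwo
  obtain ⟨B, hB⟩ := exists_nat_ge (max a 3)
  let dec : ℕ → (ℕ × ℕ) × ℕ := fun e => Denumerable.ofNat ((ℕ × ℕ) × ℕ) e
  have hdec : Primrec dec := Primrec.ofNat _
  let S : ℕ → ℕ → Prop := fun e t => R ((dec e).1, (dec e).2, t)
  -- An integer above `k r` and at most `k r + 1`, where `r` is the rational of clause `e`.
  let val : ℕ → ℕ → ℕ := fun k e => k * (dec e).1.1 / ((dec e).1.2 + 1) + 1
  have hS : PrimrecPred fun z : ℕ × ℕ => S z.1 z.2 :=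
    hR.comp (f := fun z : ℕ × ℕ => ((dec z.1).1, (dec z.1).2, z.2)) (by fun_prop)
  have hval : Primrec fun z : ℕ × ℕ => val z.1 z.2 := by
    simp only [val]
    fun_prop
  have hB3 : 3 ≤ B := by exact_mod_cast (le_max_right a 3).trans hB
  have hBa : a ≤ B := (le_max_left a 3).trans hB
  refine ⟨B, stageBound B S val, admissible_stageBound hB3 S val,
    (primrec_stageBound B hS hval).to_comp, fun ε hε => ?_, fun K => ?_⟩
  -- A rational in `(a, a + ε/2]` has a true clause that is eventually selected; the other `ε/2`
  -- absorbs the rounding and the lower limit `2 k + 1`.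
  · obtain ⟨n, hn⟩ := exists_nat_gt (2 / ε)
    have hn0 : (0 : ℝ) < (n : ℝ) + 1 := by positivity
    have hn1 : 1 / ((n : ℝ) + 1) ≤ ε / 2 := by
      rw [div_lt_iff₀ hε] at hn
      rw [div_le_div_iff₀ hn0 (by norm_num)]
      nlinarith
    set p : ℕ := ⌊a * (n + 1)⌋₊ + 1 with hp
    have hp1 : a < (p : ℝ) / ((n : ℝ) + 1) := by
      rw [lt_div_iff₀ hn0, hp]
      push_cast
      exact Nat.lt_floor_add_one _
    have hp2 : (p : ℝ) / ((n : ℝ) + 1) ≤ a + ε / 2 := by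
      have : (p : ℝ) ≤ a * (n + 1) + 1 := by
        rw [hp]
        push_cast
        gcongr
        exact Nat.floor_le (by positivity)
      calc (p : ℝ) / ((n : ℝ) + 1) ≤ (a * (n + 1) + 1) / ((n : ℝ) + 1) := by gcongr
        _ = a + 1 / ((n : ℝ) + 1) := by field_simp
        _ ≤ _ := by gcongr
    obtain ⟨s, hs⟩ := (hRa (p, n)).1 hp1
    set e := Encodable.encode ((p, n), s) with he
    have hde : dec e = ((p, n), s) := by simp [dec, he]
    have hholds : TrueStages.Holds S e := by
      intro t
      simp only [S, hde]
      exact hs t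
    obtain ⟨K, hK⟩ := hholds.eventually_selected
    obtain ⟨K', hK'⟩ := exists_nat_ge (2 / ε)
    refine ⟨K + K' + e + 1, fun k hk => ?_⟩
    have h1 := stageBound_spec B S val (show e < k by omega) (hK k (by omega))
    have hkR : (K' : ℝ) ≤ k := by exact_mod_cast (by omega : K' ≤ k)
    have hkε : 1 ≤ ε / 2 * k := by
      rw [div_le_iff₀ hε] at hK'
      nlinarith
    have h2 : (stageBound B S val k : ℝ) ≤ max (2 * (k : ℝ) + 1) (val k e) := by exact_mod_cast h1
    refine h2.trans (max_le ?_ ?_)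
    · nlinarith [(Nat.cast_nonneg k : (0 : ℝ) ≤ k)]
    · simp only [val, hde]
      push_cast
      have h3 : ((k * p / (n + 1) : ℕ) : ℝ) ≤ k * ((p : ℝ) / (n + 1)) := by
        refine Nat.cast_div_le.trans (le_of_eq ?_)
        push_cast
        ring
      have h4 : (k : ℝ) * ((p : ℝ) / (n + 1)) ≤ k * (a + ε / 2) := by gcongr
      linarith
  · obtain ⟨k, hk, hstage⟩ := TrueStages.exists_true_stage S K
    refine ⟨k, hk, ?_⟩
    -- At a true stage every selected clause has its rational above `a`, so `⌈a k⌉` is admissible in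
    -- the maximum.
    have h1 : ⌈a * k⌉₊ ≤ stageBound B S val k := by
      refine le_stageBound ?_ fun e he hs => le_max_of_le_right ?_
      · rw [Nat.ceil_le]
        push_cast
        gcongr
      · have hh := hstage e he hs
        have h2 : a < ((dec e).1.1 : ℝ) / (((dec e).1.2 : ℝ) + 1) := (hRa (dec e).1).2 ⟨(dec e).2, hh⟩
        rw [Nat.ceil_le]
        have h3 : k * (dec e).1.1 < (k * (dec e).1.1 / ((dec e).1.2 + 1) + 1) * ((dec e).1.2 + 1) :=
          Nat.lt_mul_of_div_lt (Nat.lt_succ_self _) (Nat.succ_pos _)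
        have h4 : ((k : ℝ) * (dec e).1.1) ≤ (val k e : ℝ) * (((dec e).1.2 : ℝ) + 1) := by
          exact_mod_cast h3.le
        have h5 : (0 : ℝ) < ((dec e).1.2 : ℝ) + 1 := by positivity
        rw [← div_le_iff₀ h5] at h4
        refine le_trans ?_ h4
        rw [mul_div_assoc, mul_comm]
        gcongr
    exact (Nat.le_ceil _).trans (by exact_mod_cast h1)

/-! ### The conclusion. -/

theorem corollary3 (a : ℝ) (ha : 2 ≤ a) (hce : IsRightCEInZeroJump a) :
    ∃ D : JarnikData, D.IsCantorLike ∧ D.IsComputable ∧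
      ¬ {x : ℝ | x ∈ D.limitSet ∧ HasIrrationalityExponent x a}.Countable ∧
      ({x : ℝ | x ∈ D.limitSet ∧ HasIrrationalityExponent x a ∧ IsComputableReal x}.Countable ∧
        {x : ℝ | x ∈ D.limitSet ∧ HasIrrationalityExponent x a ∧ IsComputableReal x}.Infinite) ∧
      (∃ ν : Measure ℝ, D.IsNaturalMeasure ν) ∧
      ∀ ν : Measure ℝ, D.IsNaturalMeasure ν → ∀ᵐ x ∂ν, HasIrrationalityExponent x a := by
  obtain ⟨B, u, hadm, hu, hub, hlb⟩ := hce.exists_computable ha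
  have hC := JarnikConstruction.isCantorLike hadm
  have hD := JarnikConstruction.isComputable hadm hu
  -- Since no point of the limit set is exceptional, the exponent condition drops out of all the
  -- claims, and any natural measure will do.
  have hexp : ∀ x ∈ (JarnikConstruction.data B u).limitSet, HasIrrationalityExponent x a :=
    fun x hx => JarnikConstruction.hasIrrationalityExponent hadm ha hub hlb hx
  refine ⟨JarnikConstruction.data B u, hC, hD, ?_, ⟨?_, ?_⟩, ⟨_, hC.isNaturalMeasure_map_point⟩, ?_⟩
  · intro h
    refine hC.not_countable_limitSet (h.mono ?_)
    exact fun x hx => ⟨hx, hexp x hx⟩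
  · exact countable_isComputableReal.mono fun x hx => hx.2.2
  · exact (hC.infinite_computable hD).mono fun x hx => ⟨hx.1, hexp x hx.1, hx.2⟩
  · intro ν hν
    have : ∀ᵐ x ∂ν, x ∈ (JarnikConstruction.data B u).limitSet := hν.compl_limitSet
    filter_upwards [this] with x hx using hexp x hx
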